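/- Let $V$ be a complex vector space of finite dimension $r$. A reflection of $V$ is an element $s\in GL(V)$ of finite order such that $\ker(s-\mathrm{Id})$ is a hyperplane. Let $W\subset GL(V)$ be an irreducible complex reflection group, i.e. a finite subgroup that is generated by reflections and acts irreducibly on $V$. Let $\mathcal{A}$ be the set of its reflecting hyperplanes (the hyperplanes $\ker(s-\mathrm{Id})$, $s\in W$ a reflection), $N$ the number of reflections in $W$, and $N^*=|\mathcal{A}|$. For $H\in\mathcal{A}$ let $e_H$ be the order of the pointwise stabilizer of $H$ in $W$, and let $l_H$ be a linear form on $V$ with kernel $H$. A system of basic invariants is a sequence $f=(f_1,\dots,f_r)$ of algebraically independent homogeneous polynomial functions on $V$ with $\mathbf{C}[V]^W=\mathbf{C}[f_1,\dots,f_r]$ and $\deg f_1\le\dots\le\deg f_r$. The numbers $d_i=\deg f_i$ do not depend on $f$ and are the degrees of $W$. The discriminant $\Delta_f\in\mathbf{C}[X_1,\dots,X_r]$ is the unique polynomial with $\Delta_f(f_1,\dots,f_r)=\prod_{H\in\mathcal{A}}l_H^{e_H}$. A polynomial $P\in\mathbf{C}[X_1,\dots,X_r]$ is monic in $X_i$ if,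 when it is viewed as a polynomial in $X_i$ with coefficients in the polynomial ring in the other variables, its leading coefficient is a non-zero scalar; the degree of that one-variable polynomial is the $X_i$-degree of $P$. An integer $d$ is a regular number for $W$ if it is the order of some $w\in W$ such that, for some root of unity $\zeta$, the eigenspace $\ker(w-\zeta\,\mathrm{Id})$ contains a vector lying on no hyperplane of $\mathcal{A}$. Let $i_0\in\{1,\dots,r\}$ and $d=d_{i_0}$. (i) The degree $d$ is a regular number for $W$ if and only if there exists a system of basic invariants $f$ such that $\Delta_f$ is monic in $X_{i_0}$. Moreover, for every system of basic invariants $f$ such that $\Delta_f$ is monic in $X_{i_0}$, the $X_{i_0}$-degree of $\Delta_f$ is $(N+N^*)/d$. (ii) Assume that $i_0$ is the only index $i\in\{1,\dots,r\}$ such that $d$ divides $d_i$. Then the following assertions are equivalent: $d$ is a regular number for $W$; there exists a system of basic invariants $f$ such that $\Delta_f$ is monic in $X_{i_0}$; for every system of basic invariants $f$, $\Delta_f$ is monic in $X_{i_0}$. -/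

import Mathlib

open Module

noncomputable section

namespace ComplexReflection

variable {V : Type*} [AddCommGroup V] [Module ℂ V]

/-! ### Reflections and reflection groups -/

/-- A complex reflection of `V`: an element of finite order of `GL(V)` such that
`ker (s - Id)` is a hyperplane (a maximal proper subspace). -/
def IsReflection (s : V ≃ₗ[ℂ] V) : Prop :=
  IsOfFinOrder s ∧ IsCoatom (LinearMap.ker ((s : V →ₗ[ℂ] V) - LinearMap.id))

/-- The tautological representation on `V` of a subgroup of `GL(V)`. -/
def naturalRep (W : Subgroup (V ≃ₗ[ℂ] V)) : Representation ℂ W V :=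
  LinearEquiv.automorphismGroup.toLinearMapMonoidHom.comp W.subtype

/-- An irreducible complex reflection group: a finite subgroup of `GL(V)`, generated by
reflections, for which `V` is an irreducible representation (in particular `V` is not zero). -/
structure IsIrreducibleReflectionGroup (W : Subgroup (V ≃ₗ[ℂ] V)) : Prop where
  finite : Finite W
  generated : Subgroup.closure {s : V ≃ₗ[ℂ] V | s ∈ W ∧ IsReflection s} = W
  irreducible : (naturalRep W).IsIrreducible

/-- The set of reflecting hyperplanes of `W`. -/
def hyperplanes (W : Subgroup (V ≃ₗ[ℂ] V)) : Set (Submodule ℂ V) :=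
  {H | ∃ s ∈ W, IsReflection s ∧ LinearMap.ker ((s : V →ₗ[ℂ] V) - LinearMap.id) = H}

/-- The number `N` of reflections in `W`. -/
def numReflections (W : Subgroup (V ≃ₗ[ℂ] V)) : ℕ :=
  Set.ncard {s : V ≃ₗ[ℂ] V | s ∈ W ∧ IsReflection s}

/-- The number `N*` of reflecting hyperplanes of `W`. -/
def numHyperplanes (W : Subgroup (V ≃ₗ[ℂ] V)) : ℕ :=
  Set.ncard (hyperplanes W)

/-- The order `e_H` of the pointwise fixator of `H` in `W`. -/
def fixatorOrder (W : Subgroup (V ≃ₗ[ℂ] V)) (H : Submodule ℂ V) : ℕ :=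
  Set.ncard {w : V ≃ₗ[ℂ] V | w ∈ W ∧ ∀ v ∈ H, w v = v}

/-! ### Regular vectors and regular numbers -/

/-- The set of regular vectors: those lying on no reflecting hyperplane. -/
def regularVectors (W : Subgroup (V ≃ₗ[ℂ] V)) : Set V :=
  {v | ∀ H ∈ hyperplanes W, v ∉ H}

/-- `w` is `ζ`-regular: the eigenspace `ker (w - ζ Id)` contains a regular vector. -/
def IsZetaRegular (W : Subgroup (V ≃ₗ[ℂ] V)) (ζ : ℂ) (w : V ≃ₗ[ℂ] V) : Prop :=
  ∃ v ∈ regularVectors W, w v = ζ • v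

/-- `d` is a regular number for `W`: it is the order of an element of `W` which is `ζ`-regular
for some root of unity `ζ`. -/
def IsRegularNumber (W : Subgroup (V ≃ₗ[ℂ] V)) (d : ℕ) : Prop :=
  ∃ w ∈ W, (∃ ζ : ℂ, IsOfFinOrder ζ ∧ IsZetaRegular W ζ w) ∧ orderOf w = d

/-! ### Polynomial functions and invariants -/

variable (V) in
/-- The linear forms on `V`, as a subspace of the algebra of all functions `V → ℂ`. -/
def linearForms : Submodule ℂ (V → ℂ) :=
  LinearMap.range (LinearMap.ltoFun ℂ V ℂ ℂ)

variable (V) in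
/-- The algebra `ℂ[V]` of polynomial functions on `V`. -/
def polynomialFunctions : Subalgebra ℂ (V → ℂ) :=
  Algebra.adjoin ℂ (linearForms V : Set (V → ℂ))

variable (V) in
/-- The polynomial functions on `V` that are homogeneous of degree `n`: the linear combinations of
products of `n` linear forms. -/
def homogeneousFunctions (n : ℕ) : Submodule ℂ (V → ℂ) :=
  linearForms V ^ n

/-- The algebra `ℂ[V]^W` of `W`-invariant polynomial functions on `V`. -/
def invariants (W : Subgroup (V ≃ₗ[ℂ] V)) : Subalgebra ℂ (V → ℂ) where
  carrier := {p | p ∈ polynomialFunctions V ∧ ∀ w ∈ W, ∀ v, p (w v) = p v}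
  mul_mem' := fun ha hb =>
    ⟨mul_mem ha.1 hb.1, fun w hw v => by simp [ha.2 w hw v, hb.2 w hw v]⟩
  add_mem' := fun ha hb =>
    ⟨add_mem ha.1 hb.1, fun w hw v => by simp [ha.2 w hw v, hb.2 w hw v]⟩
  algebraMap_mem' := fun c => ⟨Subalgebra.algebraMap_mem _ c, fun _ _ _ => rfl⟩

/-- `f = (f_1, …, f_r)` is a system of basic invariants of `W` with degrees `(d_1, …, d_r)`: the
`f_i` are algebraically independent, they generate `ℂ[V]^W`, each `f_i` is homogeneous of degree
`d_i`, and `d_1 ≤ … ≤ d_r`. -/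
structure IsBasicSystemWithDegrees (W : Subgroup (V ≃ₗ[ℂ] V))
    (d : Fin (finrank ℂ V) → ℕ) (f : Fin (finrank ℂ V) → V → ℂ) : Prop where
  algebraicIndependent : AlgebraicIndependent ℂ f
  adjoin_eq : Algebra.adjoin ℂ (Set.range f) = invariants W
  homogeneous : ∀ i, f i ∈ homogeneousFunctions V (d i)
  sorted : Monotone d

/-- `f` is a system of basic invariants of `W`. -/
def IsSystemOfBasicInvariants (W : Subgroup (V ≃ₗ[ℂ] V))
    (f : Fin (finrank ℂ V) → V → ℂ) : Prop :=
  ∃ d, IsBasicSystemWithDegrees W d f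

open Classical in
/-- The degrees `d_1 ≤ … ≤ d_r` of `W`: the degrees of a system of basic invariants (they do not
depend on the system, and every finite reflection group has one; the default `0` is for the other
groups). -/
def degrees (W : Subgroup (V ≃ₗ[ℂ] V)) : Fin (finrank ℂ V) → ℕ :=
  if h : ∃ d, ∃ f, IsBasicSystemWithDegrees W d f then h.choose else 0

/-! ### The discriminant -/

/-- `l` chooses for each reflecting hyperplane `H` of `W` a linear form with kernel `H`. -/
def IsChoiceOfForms (W : Subgroup (V ≃ₗ[ℂ] V)) (l : Submodule ℂ V → Dual ℂ V) : Prop :=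
  ∀ H ∈ hyperplanes W, LinearMap.ker (l H) = H

/-- The function `∏_H l_H ^ e_H` on `V`, the product being over the reflecting hyperplanes. -/
def discriminantFunction (W : Subgroup (V ≃ₗ[ℂ] V)) (l : Submodule ℂ V → Dual ℂ V) : V → ℂ :=
  ∏ᶠ H ∈ hyperplanes W, (fun v => l H v) ^ fixatorOrder W H

/-- The discriminant polynomial `Δ_f` of `W` with respect to a system `f` of basic invariants: the
preimage of `∏_H l_H ^ e_H` under the isomorphism `Φ_f : ℂ[X_1, …, X_r] → ℂ[V]^W`, `X_i ↦ f_i`. -/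
def discriminant (W : Subgroup (V ≃ₗ[ℂ] V)) (l : Submodule ℂ V → Dual ℂ V)
    (f : Fin (finrank ℂ V) → V → ℂ) : MvPolynomial (Fin (finrank ℂ V)) ℂ :=
  Function.invFun (MvPolynomial.aeval f : MvPolynomial (Fin (finrank ℂ V)) ℂ →ₐ[ℂ] (V → ℂ))
    (discriminantFunction W l)

/-! ### Monic polynomials -/

/-- The polynomial `P`, seen as a polynomial `P_{X_i}` in the single variable `X_i` with
coefficients in the polynomial ring in the other variables. -/
def asPolynomialIn {r : ℕ} (i : Fin r) (P : MvPolynomial (Fin r) ℂ) :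
    Polynomial (MvPolynomial {j : Fin r // j ≠ i} ℂ) :=
  MvPolynomial.optionEquivLeft ℂ {j : Fin r // j ≠ i}
    (MvPolynomial.rename (Equiv.optionSubtypeNe i).symm P)

/-- `P` is monic in `X_i`: the head coefficient of `P_{X_i}` is a (non-zero) scalar. -/
def IsMonicIn {r : ℕ} (i : Fin r) (P : MvPolynomial (Fin r) ℂ) : Prop :=
  ∃ c : ℂ, c ≠ 0 ∧ (asPolynomialIn i P).leadingCoeff = MvPolynomial.C c

end ComplexReflection

end

/-!
Since `Δ_f` is weighted homogeneous of weight `N + N*`, it is monic in `X_i` exactly when it does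
not vanish at the points of the `i`-th coordinate axis other than the origin. The map
`v ↦ (f_1(v), …, f_r(v))` identifies `V / W` with affine space, its Jacobian vanishes only on the
reflecting hyperplanes, and the regular vectors are those whose image lies off `Δ_f = 0`. So `Δ_f`
is monic in `X_i` if and only if some regular `v` satisfies `f_j(v) = 0` for all `j ≠ i`. Then
`ζ v`, for `ζ` a primitive `d_i`-th root of unity, lies in the orbit of `v`, and an element of `W`
that takes `v` to `ζ v` has order `d_i` because regular vectors have trivial stabilizers.

Conversely, let `w v = ζ v` with `v` regular and `w` of order `d_i`. The differential of `f_i` at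
`v` is a nonzero linear form `φ` with `φ ∘ w = ζ φ`, hence is nonzero on the `ζ`-eigenspace of `w`,
and moving `v` inside that eigenspace achieves `f_i(v) ≠ 0`. There `f_j(v) = 0` unless `d_i ∣ d_j`,
and subtracting suitable multiples of powers of `f_i` from the other `f_j` makes them all vanish
at `v`.

That `ℂ[V]^W` is a polynomial ring is Chevalley's argument: a minimal set of homogeneous generators
of the ideal spanned by the invariants of positive degree is algebraically independent.
-/

noncomputable section

namespace ComplexReflection

variable {V : Type*} [AddCommGroup V] [Module ℂ V]

/-! ### Polynomial functions -/

theorem linearForm_mem_linearForms (l : Dual ℂ V) : (fun v => l v) ∈ linearForms V :=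
  ⟨l, rfl⟩

theorem linearForm_mem (l : Dual ℂ V) : (fun v => l v) ∈ polynomialFunctions V :=
  Algebra.subset_adjoin (linearForm_mem_linearForms l)

theorem const_mem_polynomialFunctions (c : ℂ) : (fun _ => c) ∈ polynomialFunctions V :=
  Subalgebra.algebraMap_mem _ c

theorem polynomialFunctions_induction {p : (f : V → ℂ) → f ∈ polynomialFunctions V → Prop}
    (linear : ∀ l : Dual ℂ V, p (fun v => l v) (linearForm_mem l))
    (const : ∀ c : ℂ, p (fun _ => c) (const_mem_polynomialFunctions c))
    (add : ∀ f g hf hg, p f hf → p g hg → p (f + g) (add_mem hf hg))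
    (mul : ∀ f g hf hg, p f hf → p g hg → p (f * g) (mul_mem hf hg))
    {f : V → ℂ} (hf : f ∈ polynomialFunctions V) : p f hf := by
  induction hf using Algebra.adjoin_induction with
  | mem x hx => obtain ⟨l, rfl⟩ := hx; exact linear l
  | algebraMap r => exact const r
  | add x y hx hy h1 h2 => exact add _ _ hx hy h1 h2
  | mul x y hx hy h1 h2 => exact mul _ _ hx hy h1 h2

theorem comp_mem_polynomialFunctions {f : V → ℂ} (hf : f ∈ polynomialFunctions V)
    (w : V →ₗ[ℂ] V) : (fun v => f (w v)) ∈ polynomialFunctions V := by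
  induction hf using polynomialFunctions_induction with
  | linear l => exact linearForm_mem (l ∘ₗ w)
  | const c => exact const_mem_polynomialFunctions c
  | add f g _ _ h1 h2 => exact add_mem h1 h2
  | mul f g _ _ h1 h2 => exact mul_mem h1 h2

theorem homogeneousFunctions_le (n : ℕ) {f : V → ℂ} (hf : f ∈ homogeneousFunctions V n) :
    f ∈ polynomialFunctions V := by
  have h : linearForms V ^ n ≤ Subalgebra.toSubmodule (polynomialFunctions V) := by
    clear hf
    induction n with
    | zero =>
      rw [pow_zero, Submodule.one_le]
      exact one_mem (polynomialFunctions V)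
    | succ n ih0 =>
      rw [pow_succ, Submodule.mul_le]
      intro a ha b hb
      exact mul_mem (S := Subalgebra ℂ (V → ℂ)) (s := polynomialFunctions V)
        (ih0 ha) (Algebra.subset_adjoin hb)
  exact h hf

theorem homogeneousFunctions_smul {n : ℕ} {f : V → ℂ} (hf : f ∈ homogeneousFunctions V n)
    (c : ℂ) (v : V) : f (c • v) = c ^ n * f v := by
  induction n generalizing f with
  | zero =>
    rw [homogeneousFunctions, pow_zero, Submodule.mem_one] at hf
    obtain ⟨a, rfl⟩ := hf
    simp
  | succ n ih =>
    rw [homogeneousFunctions, pow_succ] at hf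
    refine Submodule.mul_induction_on hf (fun a ha b hb => ?_) fun x y hx hy => ?_
    · obtain ⟨l, rfl⟩ := hb
      simp only [Pi.mul_apply, ih ha, LinearMap.ltoFun_apply, map_smul, smul_eq_mul]
      ring
    · simp only [Pi.add_apply, hx, hy]
      ring

theorem prod_mem_homogeneousFunctions {ι : Type*} (s : Finset ι) {n : ι → ℕ} {f : ι → V → ℂ}
    (hf : ∀ i ∈ s, f i ∈ homogeneousFunctions V (n i)) :
    ∏ i ∈ s, f i ∈ homogeneousFunctions V (∑ i ∈ s, n i) := by
  classical
  induction s using Finset.induction_on with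
  | empty => simp [homogeneousFunctions]
  | insert a s ha ih =>
    rw [Finset.prod_insert ha, Finset.sum_insert ha, homogeneousFunctions, pow_add]
    exact Submodule.mul_mem_mul (hf a (by simp)) (ih fun i hi => hf i (by simp [hi]))

/-! ### Differentials -/

theorem hasLineDerivAt_linearForm (l : Dual ℂ V) (v u : V) :
    HasLineDerivAt ℂ (fun x => l x) (l u) v u := by
  have : HasDerivAt (fun t : ℂ => l v + t * l u) (l u) 0 := by
    simpa using ((hasDerivAt_id (0 : ℂ)).mul_const (l u)).const_add (l v)
  simpa [HasLineDerivAt] using this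

theorem hasLineDerivAt_const (c : ℂ) (v u : V) : HasLineDerivAt ℂ (fun _ => c) 0 v u :=
  hasDerivAt_const (0 : ℂ) c

theorem hasLineDerivAt_mul {f g : V → ℂ} {f' g' : ℂ} {v u : V}
    (hf : HasLineDerivAt ℂ f f' v u) (hg : HasLineDerivAt ℂ g g' v u) :
    HasLineDerivAt ℂ (f * g) (g v * f' + f v * g') v u := by
  have := HasDerivAt.mul hf hg
  simp only [zero_smul, add_zero] at this
  exact this.congr_deriv (by ring)

open Classical in
/-- The differential at `v` of a function on `V` all of whose line derivatives at `v` exist and are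
linear in the direction (`0` for the other functions). No topology on `V` is needed. -/
def differential (g : V → ℂ) (v : V) : Dual ℂ V :=
  if h : ∃ d : Dual ℂ V, ∀ u, HasLineDerivAt ℂ g (d u) v u then h.choose else 0

theorem differential_eq {g : V → ℂ} {v : V} {d : Dual ℂ V}
    (h : ∀ u, HasLineDerivAt ℂ g (d u) v u) : differential g v = d := by
  have h' : ∃ d : Dual ℂ V, ∀ u, HasLineDerivAt ℂ g (d u) v u := ⟨d, h⟩
  rw [differential, dif_pos h']
  ext u
  exact (h'.choose_spec u).unique (h u)

theorem exists_differential {g : V → ℂ} (hg : g ∈ polynomialFunctions V) :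
    ∃ d : V → Dual ℂ V, (∀ u, (fun v => d v u) ∈ polynomialFunctions V) ∧
      ∀ v u, HasLineDerivAt ℂ g (d v u) v u := by
  induction hg using polynomialFunctions_induction with
  | linear l =>
    exact ⟨fun _ => l, fun u => const_mem_polynomialFunctions _, hasLineDerivAt_linearForm l⟩
  | const c =>
    exact ⟨fun _ => 0, fun u => const_mem_polynomialFunctions _, hasLineDerivAt_const c⟩
  | add f g _ _ ihf ihg =>
    obtain ⟨df, hdf, hf'⟩ := ihf
    obtain ⟨dg, hdg, hg'⟩ := ihg
    exact ⟨fun v => df v + dg v, fun u => add_mem (hdf u) (hdg u),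
      fun v u => HasDerivAt.add (hf' v u) (hg' v u)⟩
  | mul f g hf hg ihf ihg =>
    obtain ⟨df, hdf, hf'⟩ := ihf
    obtain ⟨dg, hdg, hg'⟩ := ihg
    exact ⟨fun v => g v • df v + f v • dg v,
      fun u => add_mem (mul_mem hg (hdf u)) (mul_mem hf (hdg u)),
      fun v u => hasLineDerivAt_mul (hf' v u) (hg' v u)⟩

theorem hasLineDerivAt_differential {g : V → ℂ} (hg : g ∈ polynomialFunctions V) (v u : V) :
    HasLineDerivAt ℂ g (differential g v u) v u := by
  obtain ⟨d, -, h⟩ := exists_differential hg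
  rw [differential_eq (h v)]
  exact h v u

theorem differential_apply_mem {g : V → ℂ} (hg : g ∈ polynomialFunctions V) (u : V) :
    (fun v => differential g v u) ∈ polynomialFunctions V := by
  obtain ⟨d, hd, h⟩ := exists_differential hg
  simpa only [differential_eq (h _)] using hd u

theorem differential_linearForm (l : Dual ℂ V) (v : V) : differential (fun v => l v) v = l :=
  differential_eq (hasLineDerivAt_linearForm l v)

theorem differential_const (c : ℂ) (v : V) : differential (fun _ => c) v = 0 :=
  differential_eq (hasLineDerivAt_const c v)

theorem differential_add {f g : V → ℂ} (hf : f ∈ polynomialFunctions V)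
    (hg : g ∈ polynomialFunctions V) (v : V) :
    differential (f + g) v = differential f v + differential g v :=
  differential_eq fun u =>
    HasDerivAt.add (hasLineDerivAt_differential hf v u) (hasLineDerivAt_differential hg v u)

theorem differential_mul {f g : V → ℂ} (hf : f ∈ polynomialFunctions V)
    (hg : g ∈ polynomialFunctions V) (v : V) :
    differential (f * g) v = g v • differential f v + f v • differential g v :=
  differential_eq fun u =>
    hasLineDerivAt_mul (hasLineDerivAt_differential hf v u) (hasLineDerivAt_differential hg v u)

theorem differential_sum {ι : Type*} (s : Finset ι) {f : ι → V → ℂ}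
    (hf : ∀ i ∈ s, f i ∈ polynomialFunctions V) (v : V) :
    differential (∑ i ∈ s, f i) v = ∑ i ∈ s, differential (f i) v := by
  classical
  induction s using Finset.induction_on with
  | empty => exact differential_const (V := V) 0 v
  | insert a s ha ih =>
    rw [Finset.sum_insert ha, Finset.sum_insert ha, differential_add (hf a (by simp))
      (sum_mem fun i hi => hf i (by simp [hi])), ih fun i hi => hf i (by simp [hi])]

theorem differential_comp {f : V → ℂ} (hf : f ∈ polynomialFunctions V) (w : V →ₗ[ℂ] V) (v : V) :
    differential (fun x => f (w x)) v = differential f (w v) ∘ₗ w :=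
  differential_eq fun u => by
    have := hasLineDerivAt_differential hf (w v) (w u)
    simpa [HasLineDerivAt] using this

/-! ### Coordinates -/

section Coordinates

theorem aeval_pi_apply {σ X R : Type*} [CommSemiring R] (f : σ → X → R) (p : MvPolynomial σ R)
    (x : X) : MvPolynomial.aeval f p x = MvPolynomial.aeval (fun i => f i x) p :=
  MvPolynomial.comp_aeval_apply f (Pi.evalAlgHom R (fun _ : X => R) x) p

variable [FiniteDimensional ℂ V]

variable (V) in
/-- The polynomial ring in the coordinates of a basis of `V`. -/
abbrev CoordinateRing := MvPolynomial (Fin (finrank ℂ V)) ℂ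

variable (V) in
/-- The polynomial function defined by a polynomial in the coordinates of a basis of `V`. -/
def evalCoord : CoordinateRing V →ₐ[ℂ] (V → ℂ) :=
  MvPolynomial.aeval fun i v => (finBasis ℂ V).coord i v

theorem evalCoord_apply (p : CoordinateRing V) (v : V) :
    evalCoord V p v = MvPolynomial.aeval (fun i => (finBasis ℂ V).repr v i) p :=
  aeval_pi_apply _ p v

theorem evalCoord_equivFun_symm (p : CoordinateRing V)
    (x : Fin (finrank ℂ V) → ℂ) :
    evalCoord V p ((finBasis ℂ V).equivFun.symm x) = MvPolynomial.aeval x p := by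
  rw [evalCoord_apply]
  congr 2
  ext i
  exact congrFun ((finBasis ℂ V).equivFun.apply_symm_apply x) i

theorem evalCoord_injective : Function.Injective (evalCoord V) := by
  rw [injective_iff_map_eq_zero]
  intro p hp
  refine MvPolynomial.funext fun x => ?_
  have := congrFun hp ((finBasis ℂ V).equivFun.symm x)
  rw [evalCoord_equivFun_symm] at this
  simpa [MvPolynomial.coe_aeval_eq_eval] using this

/-- The linear polynomial that defines a linear form. -/
def linearPolynomial (l : Dual ℂ V) : CoordinateRing V :=
  ∑ i, MvPolynomial.C (l (finBasis ℂ V i)) * MvPolynomial.X i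

theorem evalCoord_linearPolynomial (l : Dual ℂ V) :
    evalCoord V (linearPolynomial l) = fun v => l v := by
  ext v
  rw [evalCoord_apply, linearPolynomial]
  conv_rhs => rw [← (finBasis ℂ V).sum_repr v]
  simp only [map_sum, map_mul, MvPolynomial.aeval_X, map_smul, smul_eq_mul,
    MvPolynomial.algHom_C, Algebra.algebraMap_self, RingHom.id_apply]
  exact Finset.sum_congr rfl fun i _ => mul_comm _ _

theorem linearPolynomial_isHomogeneous (l : Dual ℂ V) : (linearPolynomial l).IsHomogeneous 1 :=
  MvPolynomial.IsHomogeneous.sum _ _ _ fun i _ => by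
    simpa using (MvPolynomial.isHomogeneous_C _ _).mul (MvPolynomial.isHomogeneous_X ℂ i)

theorem evalCoord_mem (p : CoordinateRing V) :
    evalCoord V p ∈ polynomialFunctions V := by
  induction p using MvPolynomial.induction_on with
  | C a => simp [evalCoord]
  | add p q hp hq => rw [map_add]; exact add_mem hp hq
  | mul_X p i hp =>
    rw [map_mul]
    refine mul_mem hp ?_
    simpa [evalCoord] using linearForm_mem ((finBasis ℂ V).coord i)

theorem exists_evalCoord_eq {f : V → ℂ} (hf : f ∈ polynomialFunctions V) :
    ∃ p, evalCoord V p = f := by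
  induction hf using polynomialFunctions_induction with
  | linear l => exact ⟨_, evalCoord_linearPolynomial l⟩
  | const c => exact ⟨MvPolynomial.C c, by ext v; simp [evalCoord_apply]⟩
  | add f g _ _ h1 h2 =>
    obtain ⟨p, rfl⟩ := h1
    obtain ⟨q, rfl⟩ := h2
    exact ⟨p + q, map_add _ _ _⟩
  | mul f g _ _ h1 h2 =>
    obtain ⟨p, rfl⟩ := h1
    obtain ⟨q, rfl⟩ := h2
    exact ⟨p * q, map_mul _ _ _⟩

theorem evalCoord_mem_homogeneousFunctions {n : ℕ} {p : CoordinateRing V}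
    (hp : p.IsHomogeneous n) : evalCoord V p ∈ homogeneousFunctions V n := by
  rw [← p.support_sum_monomial_coeff, map_sum]
  refine sum_mem fun m hm => ?_
  have hdeg : m.sum (fun _ k => k) = n := by
    have := hp (MvPolynomial.mem_support_iff.1 hm)
    simpa [Finsupp.weight_apply] using this
  rw [evalCoord, MvPolynomial.aeval_monomial, ← Algebra.smul_def, ← hdeg]
  refine Submodule.smul_mem _ _ ?_
  exact prod_mem_homogeneousFunctions _ fun i _ =>
    Submodule.pow_mem_pow _ (linearForm_mem_linearForms ((finBasis ℂ V).coord i)) _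

end Coordinates

/-! ### Generic points of hypersurfaces -/

section GenericPoints

theorem exists_mem_forall_notMem {F : Submodule ℂ V} {s : Set (Submodule ℂ V)} (hs : s.Finite)
    (hF : ∀ G ∈ s, ¬ F ≤ G) : ∃ u ∈ F, ∀ G ∈ s, u ∉ G := by
  classical
  have htop : ⊤ ∉ hs.toFinset.image fun G => G.comap F.subtype := by
    simpa [Submodule.comap_subtype_eq_top] using hF
  obtain ⟨u, hu⟩ :=
    (Set.ne_univ_iff_exists_notMem _).1 (Subspace.biUnion_ne_univ_of_top_notMem htop)
  exact ⟨u, u.2, by simpa using hu⟩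

variable [FiniteDimensional ℂ V]

theorem exists_prime_dvd_evalCoord_eq_zero {p₀ : CoordinateRing V} (h₀ : p₀ ≠ 0)
    {v : V} (hv : evalCoord V p₀ v = 0) : ∃ p, Prime p ∧ p ∣ p₀ ∧ evalCoord V p v = 0 := by
  induction p₀ using UniqueFactorizationMonoid.induction_on_prime with
  | h₁ => exact absurd rfl h₀
  | h₂ x hx =>
    have h1 : IsUnit (evalCoord V x v) :=
      (hx.map (evalCoord V)).map (Pi.evalRingHom (fun _ : V => ℂ) v)
    exact absurd hv h1.ne_zero
  | h₃ a p ha hp ih =>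
    rw [map_mul, Pi.mul_apply, mul_eq_zero] at hv
    rcases hv with hv | hv
    · exact ⟨p, hp, dvd_mul_right _ _, hv⟩
    · obtain ⟨q, hq, hqa, hqv⟩ := ih ha hv
      exact ⟨q, hq, hqa.mul_left p, hqv⟩

theorem exists_apply_eq_mul_of_prime_dvd_linearPolynomial {p : CoordinateRing V}
    (hp : Prime p) {m : Dual ℂ V} (h : p ∣ linearPolynomial m) :
    ∃ a : ℂ, ∀ v, m v = a * evalCoord V p v := by
  obtain ⟨q, hq⟩ := h
  have heval : ∀ v, m v = evalCoord V p v * evalCoord V q v := fun v => by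
    have := congrFun (congrArg (evalCoord V) hq) v
    rwa [evalCoord_linearPolynomial, map_mul] at this
  by_cases hq0 : q = 0
  · exact ⟨0, fun v => by simp [heval, hq0]⟩
  have hdeg : p.totalDegree + q.totalDegree ≤ 1 := by
    rw [← MvPolynomial.totalDegree_mul_of_isDomain hp.ne_zero hq0, ← hq]
    exact (linearPolynomial_isHomogeneous m).totalDegree_le
  have hpdeg : p.totalDegree ≠ 0 := fun h0 => hp.not_isUnit <| by
    rw [MvPolynomial.isUnit_iff_totalDegree_of_isReduced]
    rw [MvPolynomial.totalDegree_eq_zero_iff_eq_C] at h0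
    refine ⟨IsUnit.mk0 _ fun hc => hp.ne_zero ?_, MvPolynomial.totalDegree_eq_zero_iff_eq_C.2 h0⟩
    rw [h0, hc, map_zero]
  have hqC := MvPolynomial.totalDegree_eq_zero_iff_eq_C.1 (show q.totalDegree = 0 by lia)
  exact ⟨q.coeff 0, fun v => by rw [heval, hqC]; simp [evalCoord_apply, mul_comm]⟩

theorem ker_le_ker_of_prime_dvd_linearPolynomial {p : CoordinateRing V} (hp : Prime p)
    {m m' : Dual ℂ V} (h : p ∣ linearPolynomial m) (h' : p ∣ linearPolynomial m') (hm' : m' ≠ 0) :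
    LinearMap.ker m' ≤ LinearMap.ker m := by
  obtain ⟨a, ha⟩ := exists_apply_eq_mul_of_prime_dvd_linearPolynomial hp h
  obtain ⟨b, hb⟩ := exists_apply_eq_mul_of_prime_dvd_linearPolynomial hp h'
  have hb0 : b ≠ 0 := fun h0 => hm' (LinearMap.ext fun z => by simp [hb, h0])
  intro z hz
  rw [LinearMap.mem_ker, hb] at hz
  rw [LinearMap.mem_ker, ha, (mul_eq_zero.1 hz).resolve_left hb0, mul_zero]

theorem exists_linearForm_not_dvd {p : CoordinateRing V} (hp : Prime p) {v : V}
    (hv : evalCoord V p v = 0) {F : Submodule ℂ V} (hF : F ≠ ⊤) (h : v ∉ F ∨ ¬ IsCoatom F) :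
    ∃ m : Dual ℂ V, F ≤ LinearMap.ker m ∧ ¬ p ∣ linearPolynomial m := by
  rcases h with hvF | hcoatom
  · obtain ⟨m, hm, hFm⟩ := F.exists_le_ker_of_notMem hvF
    refine ⟨m, hFm, fun ⟨q, hq⟩ => hm ?_⟩
    have := congrFun (congrArg (evalCoord V) hq) v
    rwa [evalCoord_linearPolynomial, map_mul, Pi.mul_apply, hv, zero_mul] at this
  · obtain ⟨G, hFG, hG⟩ : ∃ G, F < G ∧ G ≠ ⊤ := by
      by_contra! hG
      exact hcoatom ⟨hF, hG⟩
    obtain ⟨x, hxG, hxF⟩ := SetLike.exists_of_lt hFG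
    obtain ⟨m, hmx, hFm⟩ := F.exists_le_ker_of_notMem hxF
    obtain ⟨m', hm', hGm'⟩ := G.exists_le_ker_of_lt_top hG.lt_top
    by_contra! hdvd
    exact hmx (ker_le_ker_of_prime_dvd_linearPolynomial hp (hdvd m hFm)
      (hdvd m' (hFG.le.trans hGm')) hm' (hGm' hxG))

/- An irreducible component of the hypersurface `g = 0` through `v` is contained in none of the
subspaces, so the product of linear forms vanishing on them does not vanish identically on it. -/
theorem exists_zero_forall_notMem {g : V → ℂ} (hg : g ∈ polynomialFunctions V) {v : V}
    (hv : g v = 0) {s : Set (Submodule ℂ V)} (hs : s.Finite) (hs_top : ⊤ ∉ s)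
    (hsv : ∀ F ∈ s, v ∉ F ∨ ¬ IsCoatom F) : ∃ u, g u = 0 ∧ ∀ F ∈ s, u ∉ F := by
  obtain ⟨p₀, rfl⟩ := exists_evalCoord_eq hg
  by_cases h₀ : p₀ = 0
  · obtain ⟨u, -, hu⟩ := exists_mem_forall_notMem (F := ⊤) hs
      fun G hG hle => hs_top (top_le_iff.1 hle ▸ hG)
    exact ⟨u, by simp [h₀], hu⟩
  obtain ⟨p, hp, ⟨q, rfl⟩, hpv⟩ := exists_prime_dvd_evalCoord_eq_zero h₀ hv
  choose! m hm hmp using fun F (hF : F ∈ s) =>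
    exists_linearForm_not_dvd hp hpv (ne_of_mem_of_not_mem hF hs_top) (hsv F hF)
  have hprod : ∏ F ∈ hs.toFinset, linearPolynomial (m F) ∉ Ideal.span {p} := by
    rw [Ideal.mem_span_singleton, hp.dvd_finsetProd_iff]
    rintro ⟨F, hF, h⟩
    exact hmp F (by simpa using hF) h
  have : (Ideal.span {p}).IsPrime := (Ideal.span_singleton_prime hp.ne_zero).2 hp
  rw [← MvPolynomial.IsPrime.vanishingIdeal_zeroLocus (K := ℂ) (Ideal.span {p}),
    MvPolynomial.mem_vanishingIdeal_iff] at hprod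
  push Not at hprod
  obtain ⟨x, hx, hxp⟩ := hprod
  have hpx : MvPolynomial.aeval x p = 0 :=
    MvPolynomial.mem_zeroLocus_iff.1 hx p (Ideal.mem_span_singleton_self p)
  refine ⟨(finBasis ℂ V).equivFun.symm x, ?_, fun F hF hxF => hxp ?_⟩
  · rw [map_mul, Pi.mul_apply, evalCoord_equivFun_symm, hpx, zero_mul]
  · rw [map_prod]
    refine Finset.prod_eq_zero (i := F) (by simpa using hF) ?_
    rw [← evalCoord_equivFun_symm, evalCoord_linearPolynomial]
    exact hm F hF hxF

end GenericPoints

/-! ### Reflecting hyperplanes -/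

section Hyperplanes

/-- A complex reflection group, not necessarily irreducible: a finite subgroup of `GL(V)` generated
by reflections. -/
structure IsReflectionGroup (W : Subgroup (V ≃ₗ[ℂ] V)) : Prop where
  finite : Finite W
  generated : Subgroup.closure {s : V ≃ₗ[ℂ] V | s ∈ W ∧ IsReflection s} = W

/-- The subspace of the vectors fixed by `w`, spelled as in the definition of a reflection. -/
abbrev fixedSpace (w : V ≃ₗ[ℂ] V) : Submodule ℂ V :=
  LinearMap.ker ((w : V →ₗ[ℂ] V) - LinearMap.id)

theorem mem_fixedSpace {w : V ≃ₗ[ℂ] V} {x : V} : x ∈ fixedSpace w ↔ w x = x := by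
  simp [sub_eq_zero]

theorem fixedSpace_eq_top_iff {w : V ≃ₗ[ℂ] V} : fixedSpace w = ⊤ ↔ w = 1 := by
  simp only [Submodule.eq_top_iff', mem_fixedSpace, LinearEquiv.ext_iff, LinearEquiv.coe_one, id]

variable {W : Subgroup (V ≃ₗ[ℂ] V)}

theorem isCoatom_of_mem_hyperplanes {H : Submodule ℂ V} (hH : H ∈ hyperplanes W) :
    IsCoatom H := by
  obtain ⟨s, -, hs, rfl⟩ := hH
  exact hs.2

theorem hyperplanes_finite [Finite W] : (hyperplanes W).Finite := by
  refine ((W : Set (V ≃ₗ[ℂ] V)).toFinite.image fixedSpace).subset ?_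
  rintro H ⟨s, hs, -, rfl⟩
  exact ⟨s, hs, rfl⟩

theorem isOfFinOrder_of_mem [Finite W] {w : V ≃ₗ[ℂ] V} (hw : w ∈ W) : IsOfFinOrder w := by
  simpa using MonoidHom.isOfFinOrder W.subtype (isOfFinOrder_of_finite (⟨w, hw⟩ : W))

end Hyperplanes

/-! ### Invariants -/

section Invariants

variable {W : Subgroup (V ≃ₗ[ℂ] V)}

variable (W) in
/-- The sum of the translates of a function under `W`: the unnormalized projection onto the
invariant functions. -/
def orbitSum [Fintype W] : (V → ℂ) →ₗ[ℂ] (V → ℂ) :=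
  ∑ w : W, LinearMap.funLeft ℂ ℂ w.1

theorem orbitSum_apply [Fintype W] (g : V → ℂ) (v : V) :
    orbitSum W g v = ∑ w : W, g (w.1 v) := by
  simp [orbitSum, LinearMap.funLeft_apply]

theorem orbitSum_mem_invariants [Fintype W] {g : V → ℂ} (hg : g ∈ polynomialFunctions V) :
    orbitSum W g ∈ invariants W := by
  constructor
  · rw [orbitSum, LinearMap.sum_apply]
    exact sum_mem fun w _ => comp_mem_polynomialFunctions hg w.1.toLinearMap
  · intro w hw v
    rw [orbitSum_apply, orbitSum_apply]
    exact Equiv.sum_comp (Equiv.mulRight (⟨w, hw⟩ : W)) fun x : W => g (x.1 v)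

theorem orbitSum_mul_of_mem_invariants [Fintype W] (g : V → ℂ) {f : V → ℂ}
    (hf : f ∈ invariants W) : orbitSum W (g * f) = orbitSum W g * f := by
  ext v
  simp only [Pi.mul_apply, orbitSum_apply, Finset.sum_mul]
  exact Finset.sum_congr rfl fun w _ => by rw [hf.2 w.1 w.2]

theorem orbitSum_one [Fintype W] : orbitSum W 1 = algebraMap ℂ (V → ℂ) (Fintype.card W) := by
  ext v
  simp [orbitSum_apply]

theorem differential_orbitSum [Fintype W] {g : V → ℂ} (hg : g ∈ polynomialFunctions V) (v : V) :
    differential (orbitSum W g) v = ∑ w : W, differential g (w.1 v) ∘ₗ w.1.toLinearMap := by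
  rw [orbitSum, LinearMap.sum_apply]
  refine (differential_sum _
    (fun w _ => comp_mem_polynomialFunctions hg w.1.toLinearMap) v).trans ?_
  exact Finset.sum_congr rfl fun w _ => differential_comp hg w.1.toLinearMap v

theorem differential_apply_of_mem_invariants {f : V → ℂ} (hf : f ∈ invariants W)
    {w : V ≃ₗ[ℂ] V} (hw : w ∈ W) (v x : V) :
    differential f (w v) (w x) = differential f v x := by
  have h := differential_comp hf.1 w.toLinearMap v
  have hfw : (fun y => f (w.toLinearMap y)) = f := funext (hf.2 w hw)
  rw [hfw] at h
  exact (LinearMap.congr_fun h x).symm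

theorem exists_polynomialFunction_eq_one_eq_zero {s : Set V} (hs : s.Finite) {u : V}
    (hu : u ∉ s) : ∃ h ∈ polynomialFunctions V, h u = 1 ∧ ∀ x ∈ s, h x = 0 := by
  have := hs.to_subtype
  have := Fintype.ofFinite s
  obtain ⟨m, hm⟩ := Module.exists_dual_forall_apply_ne_zero (K := ℂ) (fun x : s => u - x)
    fun x h => hu (sub_eq_zero.1 h ▸ x.2)
  refine ⟨∏ x : s, (m (u - x))⁻¹ • fun y => m y - m x, prod_mem fun x _ => ?_, ?_, fun x hx => ?_⟩
  · exact Subalgebra.smul_mem _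
      (sub_mem (linearForm_mem m) (const_mem_polynomialFunctions (m x))) _
  · rw [Finset.prod_apply]
    exact Finset.prod_eq_one fun x _ => by simpa [map_sub] using inv_mul_cancel₀ (hm x)
  · rw [Finset.prod_apply]
    exact Finset.prod_eq_zero (Finset.mem_univ ⟨x, hx⟩) (by simp)

theorem exists_invariant_differential_eq [Finite W] {u : V} (hu : ∀ w ∈ W, w u = u → w = 1)
    (l : Dual ℂ V) : ∃ F ∈ invariants W, differential F u = l := by
  classical
  have := Fintype.ofFinite W
  obtain ⟨h, hpoly, hhu, hh0⟩ := exists_polynomialFunction_eq_one_eq_zero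
    (Set.toFinite ((fun w : W => w.1 u) '' {1}ᶜ)) (u := u) (by
      rintro ⟨w, hw1, hwu⟩
      exact hw1 (Subtype.ext (hu w.1 w.2 hwu)))
  have hl : (fun x => l x - l u) ∈ polynomialFunctions V :=
    sub_mem (linearForm_mem l) (const_mem_polynomialFunctions _)
  have hdl : differential (fun x => l x - l u) u = l := by
    have : (fun x => l x - l u) = (fun x => l x) + fun _ => - l u := by
      ext; simp [sub_eq_add_neg]
    rw [this, differential_add (linearForm_mem l) (const_mem_polynomialFunctions _),
      differential_linearForm, differential_const, add_zero]
  -- the factor `h ^ 2` kills value and differential at the other points of the orbit of `u`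
  have hg : h * h * (fun x => l x - l u) ∈ polynomialFunctions V := mul_mem (mul_mem hpoly hpoly) hl
  refine ⟨_, orbitSum_mem_invariants hg, ?_⟩
  rw [differential_orbitSum hg, Finset.sum_eq_single 1 (fun w _ hw => ?_) (by simp)]
  · change differential _ u = l
    rw [differential_mul (mul_mem hpoly hpoly) hl, hdl]
    simp [hhu]
  · rw [differential_mul (mul_mem hpoly hpoly) hl, differential_mul hpoly hpoly, Pi.mul_apply,
      hh0 _ ⟨w, hw, rfl⟩]
    simp

end Invariants

/-! ### The Jacobian -/

section Jacobian

variable [FiniteDimensional ℂ V] {f : Fin (finrank ℂ V) → V → ℂ}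

/-- The Jacobian determinant of a sequence of functions, in the coordinates of a basis of `V`. -/
def jacobian (f : Fin (finrank ℂ V) → V → ℂ) (v : V) : ℂ :=
  Matrix.det (Matrix.of fun i j => differential (f i) v (finBasis ℂ V j))

theorem jacobian_mem_polynomialFunctions (hf : ∀ i, f i ∈ polynomialFunctions V) :
    jacobian f ∈ polynomialFunctions V := by
  have : jacobian f = ∑ σ : Equiv.Perm (Fin (finrank ℂ V)),
      (Equiv.Perm.sign σ : ℤ) • ∏ i, fun v => differential (f (σ i)) v (finBasis ℂ V i) := by
    ext v
    simp [jacobian, Matrix.det_apply, Units.smul_def]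
  rw [this]
  exact sum_mem fun σ _ => zsmul_mem (prod_mem fun i _ => differential_apply_mem (hf _) _) _

theorem jacobian_eq_zero_iff {v : V} :
    jacobian f v = 0 ↔ ∃ x ≠ 0, ∀ i, differential (f i) v x = 0 := by
  have hmulVec (x : V) (i : Fin (finrank ℂ V)) :
      (Matrix.of fun i j => differential (f i) v (finBasis ℂ V j)).mulVec
        ((finBasis ℂ V).equivFun x) i = differential (f i) v x := by
    simp only [Matrix.mulVec, dotProduct, Matrix.of_apply]
    conv_rhs => rw [← (finBasis ℂ V).sum_equivFun x, map_sum]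
    exact Finset.sum_congr rfl fun j _ => by rw [map_smul, smul_eq_mul, mul_comm]
  refine (Matrix.exists_mulVec_eq_zero_iff.symm.trans
    (finBasis ℂ V).equivFun.surjective.exists).trans ?_
  simp only [ne_eq, map_eq_zero_iff _ (finBasis ℂ V).equivFun.injective, funext_iff, hmulVec,
    Pi.zero_apply]

end Jacobian

/-! ### Basic systems of invariants -/

namespace IsBasicSystemWithDegrees

variable {W : Subgroup (V ≃ₗ[ℂ] V)} {f : Fin (finrank ℂ V) → V → ℂ} {d : Fin (finrank ℂ V) → ℕ}

theorem mem_invariants (hf : IsBasicSystemWithDegrees W d f) (i) : f i ∈ invariants W :=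
  hf.adjoin_eq ▸ Algebra.subset_adjoin ⟨i, rfl⟩

theorem exists_aeval_eq (hf : IsBasicSystemWithDegrees W d f) {g : V → ℂ} (hg : g ∈ invariants W) :
    ∃ P : MvPolynomial (Fin (finrank ℂ V)) ℂ, MvPolynomial.aeval f P = g := by
  rwa [← hf.adjoin_eq, Algebra.adjoin_range_eq_range_aeval] at hg

theorem differential_eq_zero (hf : IsBasicSystemWithDegrees W d f) {v x : V}
    (hx : ∀ i, differential (f i) v x = 0) {F : V → ℂ} (hF : F ∈ invariants W) :
    differential F v x = 0 := by
  have hle : Algebra.adjoin ℂ (Set.range f) ≤ polynomialFunctions V := fun g hg => by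
    rw [hf.adjoin_eq] at hg
    exact hg.1
  rw [← hf.adjoin_eq] at hF
  induction hF using Algebra.adjoin_induction with
  | mem g hg => obtain ⟨i, rfl⟩ := hg; exact hx i
  | algebraMap c => exact congrArg (· x) (differential_const c v)
  | add g h hg hh ihg ihh =>
    rw [differential_add (hle hg) (hle hh), LinearMap.add_apply, ihg, ihh, add_zero]
  | mul g h hg hh ihg ihh => rw [differential_mul (hle hg) (hle hh)]; simp [ihg, ihh]

section Jacobian

variable [FiniteDimensional ℂ V] [Finite W]

theorem jacobian_ne_zero_of_free (hf : IsBasicSystemWithDegrees W d f) {u : V}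
    (hu : ∀ w ∈ W, w u = u → w = 1) : jacobian f u ≠ 0 := by
  intro h
  obtain ⟨x, hx, hfx⟩ := jacobian_eq_zero_iff.1 h
  refine hx ((Module.forall_dual_apply_eq_zero_iff ℂ x).1 fun l => ?_)
  obtain ⟨F, hF, rfl⟩ := exists_invariant_differential_eq hu l
  exact hf.differential_eq_zero hfx hF

/- The points with non-trivial stabilizer that lie on no reflecting hyperplane lie on finitely many
subspaces of codimension at least two, which contain no component of the zero set of the
Jacobian. -/
theorem jacobian_ne_zero (hf : IsBasicSystemWithDegrees W d f) {v : V}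
    (hv : v ∈ regularVectors W) : jacobian f v ≠ 0 := by
  intro h
  have htop : ⊤ ∉ fixedSpace '' ((W : Set (V ≃ₗ[ℂ] V)) \ {1}) := by
    rintro ⟨w, ⟨-, hw1⟩, hw⟩
    exact hw1 (fixedSpace_eq_top_iff.1 hw)
  have hreg : ∀ F ∈ fixedSpace '' ((W : Set (V ≃ₗ[ℂ] V)) \ {1}), v ∉ F ∨ ¬ IsCoatom F := by
    rintro _ ⟨w, ⟨hw, -⟩, rfl⟩
    by_contra! hcon
    exact hv _ ⟨w, hw, ⟨isOfFinOrder_of_mem hw, hcon.2⟩, rfl⟩ hcon.1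
  obtain ⟨u, hu, huF⟩ := exists_zero_forall_notMem
    (jacobian_mem_polynomialFunctions fun i => (hf.mem_invariants i).1) h
    (((W : Set (V ≃ₗ[ℂ] V)).toFinite.sdiff).image _) htop hreg
  refine hf.jacobian_ne_zero_of_free (fun w hw hwu => ?_) hu
  by_contra hw1
  exact huF _ ⟨w, ⟨hw, hw1⟩, rfl⟩ (mem_fixedSpace.2 hwu)

/- If `w` fixes `v`, then the differentials at `v` of all invariants vanish on every `w x - x`. -/
theorem eq_one_of_apply_eq (hf : IsBasicSystemWithDegrees W d f) {v : V}
    (hv : v ∈ regularVectors W) {w : V ≃ₗ[ℂ] V} (hw : w ∈ W) (hwv : w v = v) : w = 1 := by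
  by_contra hw1
  obtain ⟨x, hx⟩ : ∃ x, w x ≠ x := by
    by_contra! h
    exact hw1 (LinearEquiv.ext h)
  refine hf.jacobian_ne_zero hv (jacobian_eq_zero_iff.2 ⟨w x - x, sub_ne_zero.2 hx, fun i => ?_⟩)
  have := differential_apply_of_mem_invariants (hf.mem_invariants i) hw v x
  rw [map_sub, sub_eq_zero, ← this, hwv]

theorem differential_ne_zero (hf : IsBasicSystemWithDegrees W d f) {v : V}
    (hv : v ∈ regularVectors W) (i : Fin (finrank ℂ V)) : differential (f i) v ≠ 0 :=
  fun h => hf.jacobian_ne_zero hv (Matrix.det_eq_zero_of_row_eq_zero i fun j => by simp [h])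

end Jacobian

end IsBasicSystemWithDegrees

/-! ### The quotient map -/

section QuotientMap

theorem exists_sum_mul_eq_one [FiniteDimensional ℂ V] {ι : Type*} [Fintype ι] {g : ι → V → ℂ}
    (hg : ∀ i, g i ∈ polynomialFunctions V) (hzero : ∀ v, ∃ i, g i v ≠ 0) :
    ∃ c : ι → V → ℂ, (∀ i, c i ∈ polynomialFunctions V) ∧ ∑ i, c i * g i = 1 := by
  choose p hp using fun i => exists_evalCoord_eq (hg i)
  have htop : Ideal.span (Set.range p) = ⊤ := by
    rw [← Ideal.radical_eq_top, ← MvPolynomial.vanishingIdeal_zeroLocus_eq_radical (K := ℂ),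
      Ideal.eq_top_iff_one, MvPolynomial.mem_vanishingIdeal_iff]
    intro x hx
    obtain ⟨i, hi⟩ := hzero ((finBasis ℂ V).equivFun.symm x)
    rw [← hp, evalCoord_equivFun_symm] at hi
    exact absurd (MvPolynomial.mem_zeroLocus_iff.1 hx _ (Ideal.subset_span ⟨i, rfl⟩)) hi
  obtain ⟨c, hc⟩ := Ideal.mem_span_range_iff_exists_fun.1 (htop ▸ Submodule.mem_top (x := 1))
  refine ⟨fun i => evalCoord V (c i), fun i => evalCoord_mem _, ?_⟩
  simpa [hp] using congrArg (evalCoord V) hc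

variable {W : Subgroup (V ≃ₗ[ℂ] V)} {f : Fin (finrank ℂ V) → V → ℂ} {d : Fin (finrank ℂ V) → ℕ}

theorem IsBasicSystemWithDegrees.exists_apply_eq [FiniteDimensional ℂ V] [Finite W]
    (hf : IsBasicSystemWithDegrees W d f) (a : Fin (finrank ℂ V) → ℂ) : ∃ v, ∀ i, f i v = a i := by
  by_contra! hcon
  have := Fintype.ofFinite W
  have hinv (i) : f i - algebraMap ℂ (V → ℂ) (a i) ∈ invariants W :=
    sub_mem (hf.mem_invariants i) (Subalgebra.algebraMap_mem _ _)
  obtain ⟨c, hc, hsum⟩ := exists_sum_mul_eq_one (fun i => (hinv i).1) fun v => by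
    obtain ⟨i, hi⟩ := hcon v
    exact ⟨i, sub_ne_zero.2 hi⟩
  choose Q hQ using fun i => hf.exists_aeval_eq (orbitSum_mem_invariants (W := W) (hc i))
  have hcard : ∑ i, orbitSum W (c i) * (f i - algebraMap ℂ (V → ℂ) (a i)) =
      algebraMap ℂ (V → ℂ) (Fintype.card W) := by
    rw [← orbitSum_one, ← hsum, map_sum]
    exact Finset.sum_congr rfl fun i _ => (orbitSum_mul_of_mem_invariants _ (hinv i)).symm
  have hpoly : ∑ i, Q i * (MvPolynomial.X i - MvPolynomial.C (a i)) =
      MvPolynomial.C (Fintype.card W : ℂ) := by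
    refine hf.algebraicIndependent ?_
    simpa only [map_sum, map_mul, map_sub, hQ, MvPolynomial.aeval_X, MvPolynomial.algHom_C]
      using hcard
  have := congrArg (MvPolynomial.eval a) hpoly
  simp only [map_sum, map_mul, map_sub, MvPolynomial.eval_X, MvPolynomial.eval_C, sub_self,
    mul_zero, Finset.sum_const_zero] at this
  exact Nat.cast_ne_zero.2 Fintype.card_ne_zero this.symm

theorem IsBasicSystemWithDegrees.exists_mem_apply_eq [Finite W]
    (hf : IsBasicSystemWithDegrees W d f) {v v' : V} (h : ∀ i, f i v = f i v') :
    ∃ w ∈ W, w v = v' := by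
  classical
  have := Fintype.ofFinite W
  by_contra! hcon
  obtain ⟨g, hg, hgv', hg0⟩ := exists_polynomialFunction_eq_one_eq_zero (u := v')
    ((Set.toFinite (Set.range fun w : W => w.1 v)).union
      (Set.toFinite (Set.range fun w : W => w.1 v') |>.sdiff (t := {v'}))) (by
        rintro (⟨w, hw⟩ | hw)
        exacts [hcon w.1 w.2 hw, hw.2 rfl])
  obtain ⟨P, hP⟩ := hf.exists_aeval_eq (orbitSum_mem_invariants (W := W) hg)
  have heq : orbitSum W g v = orbitSum W g v' := by
    rw [← hP, aeval_pi_apply, aeval_pi_apply, funext h]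
  have hv : orbitSum W g v = 0 := by
    rw [orbitSum_apply]
    exact Finset.sum_eq_zero fun w _ => hg0 _ (Or.inl ⟨w, rfl⟩)
  have hterm (w : W) : g (w.1 v') = if w.1 v' = v' then 1 else 0 := by
    split_ifs with hw
    · rw [hw, hgv']
    · exact hg0 _ (Or.inr ⟨⟨w, rfl⟩, hw⟩)
  rw [hv, orbitSum_apply, Finset.sum_congr rfl fun w _ => hterm w, Finset.sum_boole, eq_comm,
    Nat.cast_eq_zero, Finset.card_eq_zero] at heq
  exact Finset.eq_empty_iff_forall_notMem.1 heq 1 (by simp)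

end QuotientMap

/-! ### The discriminant function -/

section DiscriminantFunction

variable {W : Subgroup (V ≃ₗ[ℂ] V)}

theorem comap_mem_hyperplanes [Finite W] {w : V ≃ₗ[ℂ] V} (hw : w ∈ W) {H : Submodule ℂ V}
    (hH : H ∈ hyperplanes W) : H.comap w.toLinearMap ∈ hyperplanes W := by
  have hcoatom : IsCoatom (H.comap w.toLinearMap) :=
    ((Submodule.orderIsoMapComap w).symm.isCoatom_iff H).2 (isCoatom_of_mem_hyperplanes hH)
  obtain ⟨s, hs, -, rfl⟩ := hH
  have hmem : w⁻¹ * s * w ∈ W := mul_mem (mul_mem (inv_mem hw) hs) hw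
  have hfixed : fixedSpace (w⁻¹ * s * w) = (fixedSpace s).comap w.toLinearMap := by
    ext x
    rw [mem_fixedSpace, Submodule.mem_comap, mem_fixedSpace]
    exact LinearEquiv.symm_apply_eq w
  rw [← hfixed] at hcoatom
  exact ⟨_, hmem, ⟨isOfFinOrder_of_mem hmem, hcoatom⟩, hfixed⟩

theorem fixatorOrder_eq_card (H : Submodule ℂ V) :
    fixatorOrder W H = Nat.card ↥(W ⊓ fixingSubgroup (V ≃ₗ[ℂ] V) (H : Set V)) := by
  rw [fixatorOrder, ← Nat.card_coe_set_eq]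
  refine congrArg Nat.card (congrArg (fun s : Set (V ≃ₗ[ℂ] V) => ↥s) ?_)
  ext w
  simp [mem_fixingSubgroup_iff]

theorem fixatorOrder_pos [Finite W] (H : Submodule ℂ V) : 0 < fixatorOrder W H :=
  (Set.ncard_pos ((W : Set (V ≃ₗ[ℂ] V)).toFinite.subset fun _ h => h.1)).2
    ⟨1, one_mem W, fun _ _ => rfl⟩

theorem fixatorOrder_comap {w : V ≃ₗ[ℂ] V} (hw : w ∈ W) (H : Submodule ℂ V) :
    fixatorOrder W (H.comap w.toLinearMap) = fixatorOrder W H := by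
  rw [fixatorOrder, fixatorOrder, ← Set.ncard_image_of_injective _ (MulAut.conj w).injective]
  congr 1
  ext g
  simp only [Set.mem_image, Set.mem_ofPred_eq, MulAut.conj_apply, Submodule.mem_comap]
  constructor
  · rintro ⟨h, ⟨hh, hfix⟩, rfl⟩
    refine ⟨mul_mem (mul_mem hw hh) (inv_mem hw), fun v hv => ?_⟩
    have hwv : w (w.symm v) = v := w.apply_symm_apply v
    have hhv : h (w.symm v) = w.symm v := hfix _ (by rwa [LinearEquiv.coe_coe, hwv])
    exact (congrArg w hhv).trans hwv
  · rintro ⟨hg, hfix⟩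
    refine ⟨w⁻¹ * g * w, ⟨mul_mem (mul_mem (inv_mem hw) hg) hw, fun v hv => ?_⟩, by group⟩
    exact (congrArg w.symm (hfix _ hv)).trans (w.symm_apply_apply v)

theorem eq_one_or_of_fixes [Finite W] {w : V ≃ₗ[ℂ] V} (hw : w ∈ W) {H : Submodule ℂ V}
    (hH : H ∈ hyperplanes W) (h : ∀ v ∈ H, w v = v) :
    w = 1 ∨ IsReflection w ∧ fixedSpace w = H := by
  have hcoatom := isCoatom_of_mem_hyperplanes hH
  have hle : H ≤ fixedSpace w := fun v hv => mem_fixedSpace.2 (h v hv)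
  rcases hcoatom.le_iff.1 hle with htop | heq
  · exact Or.inl (fixedSpace_eq_top_iff.1 htop)
  · rw [← heq] at hcoatom
    exact Or.inr ⟨⟨isOfFinOrder_of_mem hw, hcoatom⟩, heq⟩

theorem fixatorOrder_eq_ncard_add_one [Finite W] {H : Submodule ℂ V} (hH : H ∈ hyperplanes W) :
    fixatorOrder W H =
      {s : V ≃ₗ[ℂ] V | (s ∈ W ∧ IsReflection s) ∧ fixedSpace s = H}.ncard + 1 := by
  have hfin : {s : V ≃ₗ[ℂ] V | (s ∈ W ∧ IsReflection s) ∧ fixedSpace s = H}.Finite :=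
    (W : Set (V ≃ₗ[ℂ] V)).toFinite.subset fun _ h => h.1.1
  rw [fixatorOrder, ← Set.ncard_insert_of_notMem (a := 1) _ hfin]
  · congr 1
    ext w
    constructor
    · rintro ⟨hw, h⟩
      exact (eq_one_or_of_fixes hw hH h).imp id fun h => ⟨⟨hw, h.1⟩, h.2⟩
    · rintro (rfl | ⟨⟨hw, -⟩, rfl⟩)
      · exact ⟨one_mem W, fun _ _ => rfl⟩
      · exact ⟨hw, fun v hv => mem_fixedSpace.1 hv⟩
  · rintro ⟨-, h⟩
    exact (isCoatom_of_mem_hyperplanes hH).1 (h ▸ fixedSpace_eq_top_iff.2 rfl)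

theorem sum_fixatorOrder [Finite W] :
    ∑ H ∈ (hyperplanes_finite (W := W)).toFinset, fixatorOrder W H =
      numReflections W + numHyperplanes W := by
  classical
  have hfin : {s : V ≃ₗ[ℂ] V | s ∈ W ∧ IsReflection s}.Finite :=
    (W : Set (V ≃ₗ[ℂ] V)).toFinite.subset fun _ h => h.1
  rw [numReflections, Set.ncard_eq_toFinset_card _ hfin, numHyperplanes,
    Set.ncard_eq_toFinset_card _ hyperplanes_finite,
    Finset.card_eq_sum_ones hyperplanes_finite.toFinset,
    Finset.card_eq_sum_card_fiberwise (f := fixedSpace)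
      (t := (hyperplanes_finite (W := W)).toFinset), ← Finset.sum_add_distrib]
  · refine Finset.sum_congr rfl fun H hH => ?_
    rw [fixatorOrder_eq_ncard_add_one ((Set.Finite.mem_toFinset _).1 hH), ← Set.ncard_coe_finset]
    simp only [Finset.coe_filter, Set.Finite.mem_toFinset, Set.mem_ofPred_eq]
  · intro s hs
    simp only [Set.Finite.coe_toFinset, Set.mem_ofPred_eq] at hs ⊢
    exact ⟨s, hs.1, hs.2, rfl⟩

theorem exists_smul_eq_of_ker_le_ker {K E : Type*} [Field K] [AddCommGroup E] [Module K E]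
    {m m' : Dual K E} (h : LinearMap.ker m ≤ LinearMap.ker m') : ∃ c : K, c • m = m' := by
  have hspan := mem_span_of_iInf_ker_le_ker (L := fun _ : Unit => m) (K := m')
    ((iInf_const (ι := Unit)).le.trans h)
  rwa [Set.range_const, Submodule.mem_span_singleton] at hspan

theorem apply_pow_fixatorOrder {m : Dual ℂ V} {s : V ≃ₗ[ℂ] V} (hs : s ∈ W)
    (hfix : ∀ v ∈ LinearMap.ker m, s v = v) (v : V) :
    m (s v) ^ fixatorOrder W (LinearMap.ker m) = m v ^ fixatorOrder W (LinearMap.ker m) := by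
  set n := fixatorOrder W (LinearMap.ker m) with hn
  have hker : LinearMap.ker m ≤ LinearMap.ker (m ∘ₗ s.toLinearMap) := fun x hx => by
    rw [LinearMap.mem_ker, LinearMap.comp_apply, LinearEquiv.coe_coe, hfix x hx]
    exact hx
  obtain ⟨c, hc⟩ := exists_smul_eq_of_ker_le_ker hker
  have hms (x : V) : m (s x) = c * m x := (LinearMap.congr_fun hc x).symm
  have hiter (k : ℕ) : m ((s ^ k) v) = c ^ k * m v := by
    induction k with
    | zero => simp
    | succ k ih => rw [pow_succ', LinearEquiv.mul_apply, hms, ih, pow_succ', mul_assoc]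
  have hsn : s ^ n = 1 := by
    rw [hn, fixatorOrder_eq_card]
    exact orderOf_dvd_iff_pow_eq_one.1
      (Subgroup.orderOf_dvd_natCard _ ⟨hs, (mem_fixingSubgroup_iff _).2 hfix⟩)
  have hcn : c ^ n * m v = m v := by rw [← hiter, hsn, LinearEquiv.coe_one, id]
  rcases eq_or_ne (m v) 0 with hv | hv
  · rw [hms, hv, mul_zero]
  · rw [hms, mul_pow, mul_right_cancel₀ hv (hcn.trans (one_mul _).symm), one_mul]

variable {l : Submodule ℂ V → Dual ℂ V}

theorem exists_prod_apply_eq_mul (hl : IsChoiceOfForms W l) {w : V ≃ₗ[ℂ] V} (hw : w ∈ W)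
    {A : Finset (Submodule ℂ V)} (hA : ∀ H ∈ A, H ∈ hyperplanes W)
    (hcomap : ∀ H ∈ A, H.comap w.toLinearMap ∈ A) :
    ∃ c : ℂ, ∀ v, ∏ H ∈ A, l H (w v) ^ fixatorOrder W H =
      c * ∏ H ∈ A, l H v ^ fixatorOrder W H := by
  classical
  have hform : ∀ H ∈ A, ∃ c : ℂ, c • l (H.comap w.toLinearMap) = l H ∘ₗ w.toLinearMap := by
    intro H hH
    apply exists_smul_eq_of_ker_le_ker
    rw [hl _ (hA _ (hcomap H hH)), LinearMap.ker_comp, hl H (hA H hH)]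
  choose! c hc using hform
  have hinj : Function.Injective (Submodule.comap w.toLinearMap) :=
    Submodule.comap_injective_of_surjective w.surjective
  have himage : A.image (Submodule.comap w.toLinearMap) = A :=
    Finset.eq_of_subset_of_card_le (Finset.image_subset_iff.2 hcomap)
      (Finset.card_image_of_injective A hinj).ge
  refine ⟨∏ H ∈ A, c H ^ fixatorOrder W H, fun v => ?_⟩
  calc ∏ H ∈ A, l H (w v) ^ fixatorOrder W H
      = ∏ H ∈ A, c H ^ fixatorOrder W H *
          l (H.comap w.toLinearMap) v ^ fixatorOrder W (H.comap w.toLinearMap) :=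
        Finset.prod_congr rfl fun H hH => by
          have hlw : l H (w v) = c H * l (H.comap w.toLinearMap) v :=
            (LinearMap.congr_fun (hc H hH) v).symm
          rw [hlw, mul_pow, fixatorOrder_comap hw]
    _ = (∏ H ∈ A, c H ^ fixatorOrder W H) *
          ∏ H ∈ A.image (Submodule.comap w.toLinearMap), l H v ^ fixatorOrder W H := by
        rw [Finset.prod_mul_distrib, Finset.prod_image hinj.injOn]
    _ = _ := by rw [himage]

section Finite

variable [Finite W]

theorem discriminantFunction_apply (v : V) : discriminantFunction W l v =
    ∏ H ∈ (hyperplanes_finite (W := W)).toFinset, l H v ^ fixatorOrder W H := by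
  rw [discriminantFunction, finprod_mem_eq_finite_toFinset_prod _ hyperplanes_finite,
    Finset.prod_apply]
  rfl

theorem discriminantFunction_mem_homogeneousFunctions :
    discriminantFunction W l ∈ homogeneousFunctions V (numReflections W + numHyperplanes W) := by
  rw [discriminantFunction, finprod_mem_eq_finite_toFinset_prod _ hyperplanes_finite,
    ← sum_fixatorOrder]
  exact prod_mem_homogeneousFunctions _ fun H _ =>
    Submodule.pow_mem_pow _ (linearForm_mem_linearForms (l H)) _

theorem discriminantFunction_ne_zero_iff (hl : IsChoiceOfForms W l) {v : V} :
    discriminantFunction W l v ≠ 0 ↔ v ∈ regularVectors W := by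
  rw [discriminantFunction_apply, Finset.prod_ne_zero_iff]
  refine forall_congr' fun H => ?_
  rw [Set.Finite.mem_toFinset]
  refine imp_congr_right fun hH => ?_
  rw [pow_ne_zero_iff (fixatorOrder_pos H).ne', ne_eq, ← LinearMap.mem_ker, hl H hH]

theorem discriminantFunction_reflection_apply (hl : IsChoiceOfForms W l) {s : V ≃ₗ[ℂ] V}
    (hs : s ∈ W) (hrefl : IsReflection s) (v : V) :
    discriminantFunction W l (s v) = discriminantFunction W l v := by
  classical
  set H₀ := fixedSpace s
  have hH₀ : H₀ ∈ hyperplanes W := ⟨s, hs, hrefl, rfl⟩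
  set A := (hyperplanes_finite (W := W)).toFinset
  have hA : ∀ H ∈ A.erase H₀, H ∈ hyperplanes W ∧ H ≠ H₀ := fun H hH =>
    ⟨(Set.Finite.mem_toFinset _).1 (Finset.mem_of_mem_erase hH), Finset.ne_of_mem_erase hH⟩
  have hcomap₀ : H₀.comap s.toLinearMap = H₀ := by
    ext x
    rw [Submodule.mem_comap, LinearEquiv.coe_coe, mem_fixedSpace, mem_fixedSpace,
      s.injective.eq_iff]
  -- The product over the other hyperplanes is an eigenfunction of `s`. The eigenvalue is read off
  -- at a point of `H₀`, fixed by `s`, where this product does not vanish.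
  obtain ⟨c, hc⟩ := exists_prod_apply_eq_mul hl hs (A := A.erase H₀) (fun H hH => (hA H hH).1)
    fun H hH => Finset.mem_erase.2 ⟨fun h => (hA H hH).2
      (Submodule.comap_injective_of_surjective s.surjective (h.trans hcomap₀.symm)),
      (Set.Finite.mem_toFinset _).2 (comap_mem_hyperplanes hs (hA H hH).1)⟩
  obtain ⟨u, hu₀, hu⟩ := exists_mem_forall_notMem (F := H₀) (A.erase H₀).finite_toSet
    fun H hH hle => (hrefl.2.le_iff.1 hle).elim
      (isCoatom_of_mem_hyperplanes (hA H hH).1).1 (hA H hH).2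
  have hc_one : c = 1 := by
    have hprod : ∏ H ∈ A.erase H₀, l H u ^ fixatorOrder W H ≠ 0 :=
      Finset.prod_ne_zero_iff.2 fun H hH => pow_ne_zero _ fun h =>
        hu H hH (hl H (hA H hH).1 ▸ LinearMap.mem_ker.2 h)
    have hcu := hc u
    rw [mem_fixedSpace.1 hu₀] at hcu
    exact (mul_eq_right₀ hprod).1 hcu.symm
  have hker : LinearMap.ker (l H₀) = H₀ := hl H₀ hH₀
  have hl₀ := apply_pow_fixatorOrder (m := l H₀) hs
    (fun x hx => mem_fixedSpace.1 (hker.le hx)) v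
  rw [hker] at hl₀
  have hmem₀ : H₀ ∈ A := (Set.Finite.mem_toFinset _).2 hH₀
  rw [discriminantFunction_apply, discriminantFunction_apply, ← Finset.mul_prod_erase A _ hmem₀,
    ← Finset.mul_prod_erase A _ hmem₀, hc, hc_one, one_mul, hl₀]

end Finite

theorem discriminantFunction_mem_invariants (hW : IsReflectionGroup W)
    (hl : IsChoiceOfForms W l) : discriminantFunction W l ∈ invariants W := by
  have := hW.finite
  refine ⟨homogeneousFunctions_le _ discriminantFunction_mem_homogeneousFunctions,
    fun w hw => ?_⟩
  rw [← hW.generated] at hw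
  induction hw using Subgroup.closure_induction with
  | mem s hs => exact discriminantFunction_reflection_apply hl hs.1 hs.2
  | one => exact fun v => rfl
  | mul a b _ _ ha hb => exact fun v => by rw [LinearEquiv.mul_apply, ha, hb]
  | inv a _ ha => exact fun v => (ha _).symm.trans (congrArg _ (a.apply_symm_apply v))

end DiscriminantFunction

/-! ### Monic polynomials -/

section Monic

open MvPolynomial

section CommSemiring

variable {σ R : Type*} [CommSemiring R]

theorem coeff_aeval_C_mul_X (c : σ → R) (P : MvPolynomial σ R) (m : σ →₀ ℕ) :
    coeff m (aeval (fun i => C (c i) * X i : σ → MvPolynomial σ R) P) =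
      (m.prod fun i k => c i ^ k) * coeff m P := by
  classical
  induction P using MvPolynomial.induction_on' with
  | monomial u a =>
    have haeval : aeval (fun i => C (c i) * X i : σ → MvPolynomial σ R) (monomial u a) =
        monomial u ((u.prod fun i k => c i ^ k) * a) := by
      rw [aeval_monomial, monomial_eq, algebraMap_eq]
      simp only [mul_pow, Finsupp.prod, Finset.prod_mul_distrib, C_mul, map_prod, C_pow]
      ring
    rw [haeval, coeff_monomial, coeff_monomial]
    split_ifs with h
    · rw [h]
    · rw [mul_zero]
  | add p q hp hq => rw [map_add, coeff_add, coeff_add, hp, hq, mul_add]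

theorem prod_pow_piSingle_eq_zero [DecidableEq σ] {i : σ} {m : σ →₀ ℕ}
    (hm : m ≠ Finsupp.single i (m i)) (t : R) :
    ∏ j ∈ m.support, (Pi.single i t : σ → R) j ^ m j = 0 := by
  obtain ⟨j, hj⟩ := Finsupp.ne_iff.1 hm
  have hji : j ≠ i := by
    rintro rfl
    exact hj Finsupp.single_eq_same.symm
  rw [Finsupp.single_eq_of_ne hji] at hj
  exact Finset.prod_eq_zero (Finsupp.mem_support_iff.2 hj)
    (by rw [Pi.single_eq_of_ne hji, zero_pow hj])

theorem exists_coeff_single_ne_zero [DecidableEq σ] {P : MvPolynomial σ R} {i : σ} {t : R}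
    (h : aeval (Pi.single i t : σ → R) P ≠ 0) : ∃ k, coeff (Finsupp.single i k) P ≠ 0 := by
  rw [aeval_def, eval₂_eq] at h
  obtain ⟨m, hm, hne⟩ := Finset.exists_ne_zero_of_sum_ne_zero h
  have hsingle : m = Finsupp.single i (m i) := by
    by_contra hm
    exact hne (by rw [prod_pow_piSingle_eq_zero hm, mul_zero])
  exact ⟨m i, hsingle ▸ mem_support_iff.1 hm⟩

variable {d : σ → ℕ} {P : MvPolynomial σ R} {n k : ℕ} {i : σ}

theorem mul_eq_of_coeff_single_ne_zero (hP : P.IsWeightedHomogeneous d n)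
    (h : coeff (Finsupp.single i k) P ≠ 0) : k * d i = n := by
  have hweight := hP h
  rwa [Finsupp.weight_single, smul_eq_mul] at hweight

theorem aeval_piSingle_of_isWeightedHomogeneous [DecidableEq σ] (hd : 0 < d i)
    (hP : P.IsWeightedHomogeneous d n) (hk : k * d i = n) (t : R) :
    aeval (Pi.single i t : σ → R) P = coeff (Finsupp.single i k) P * t ^ k := by
  rw [aeval_def, eval₂_eq, Finset.sum_eq_single (Finsupp.single i k)]
  · rcases eq_or_ne k 0 with rfl | hk0
    · simp
    · simp [Finsupp.support_single _ hk0]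
  · intro m hm hne
    rw [prod_pow_piSingle_eq_zero _ t, mul_zero]
    intro hsingle
    have hmi : m i * d i = n := mul_eq_of_coeff_single_ne_zero hP
      (hsingle ▸ mem_support_iff.1 hm)
    rw [hsingle, Nat.eq_of_mul_eq_mul_right hd (hmi.trans hk.symm)] at hne
    exact hne rfl
  · intro h
    simp [notMem_support_iff.1 h]

end CommSemiring

variable {r : ℕ} {d : Fin r → ℕ} {P : MvPolynomial (Fin r) ℂ} {n k : ℕ} {i : Fin r}

theorem coeff_coeff_asPolynomialIn (P : MvPolynomial (Fin r) ℂ) (i : Fin r) (k : ℕ)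
    (m : {j : Fin r // j ≠ i} →₀ ℕ) :
    coeff m ((asPolynomialIn i P).coeff k) =
      coeff (Finsupp.single i k + m.mapDomain Subtype.val) P := by
  have hcoeff := optionEquivLeft_coeff_some_coeff_none ℂ {j : Fin r // j ≠ i} (m.optionElim k)
    (rename (Equiv.optionSubtypeNe i).symm P)
  simp only [Finsupp.some_optionElim, Finsupp.optionElim_apply_none] at hcoeff
  have hsome : (Equiv.optionSubtypeNe i).symm ∘ Subtype.val =
      (some : {j : Fin r // j ≠ i} → _) := by
    ext j
    simp [j.2]
  have hexponent : m.optionElim k = (Finsupp.single i k + m.mapDomain Subtype.val).mapDomain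
      (Equiv.optionSubtypeNe i).symm := by
    rw [Finsupp.mapDomain_add, Finsupp.mapDomain_single, ← Finsupp.mapDomain_comp,
      Equiv.optionSubtypeNe_symm_self, hsome]
    ext (_ | j)
    · simp [Finsupp.mapDomain_of_notMem_range]
    · simp [Finsupp.mapDomain_apply (Option.some_injective _)]
  rw [asPolynomialIn, hcoeff, hexponent, coeff_rename_mapDomain _ (Equiv.injective _)]

theorem IsMonicIn.coeff_ne_zero (h : IsMonicIn i P) :
    coeff (Finsupp.single i (asPolynomialIn i P).natDegree) P ≠ 0 := by
  obtain ⟨c, hc, hlead⟩ := h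
  have hcoeff := coeff_coeff_asPolynomialIn P i (asPolynomialIn i P).natDegree 0
  rw [Polynomial.coeff_natDegree, hlead, coeff_zero_C, Finsupp.mapDomain_zero, add_zero] at hcoeff
  rwa [← hcoeff]

theorem eq_and_eq_zero_of_coeff_asPolynomialIn_ne_zero (hd : ∀ j, 0 < d j)
    (hP : P.IsWeightedHomogeneous d n) (hk : k * d i = n) {k' : ℕ} (hkk' : k ≤ k')
    {m : {j : Fin r // j ≠ i} →₀ ℕ} (hm : coeff m ((asPolynomialIn i P).coeff k') ≠ 0) :
    k' = k ∧ m = 0 := by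
  rw [coeff_coeff_asPolynomialIn] at hm
  have hweight := hP hm
  rw [map_add, Finsupp.weight_single, smul_eq_mul, ← hk] at hweight
  have hmul := Nat.mul_le_mul_right (d i) hkk'
  refine ⟨Nat.eq_of_mul_eq_mul_right (hd i) (by omega), ?_⟩
  by_contra hm0
  obtain ⟨j, hj⟩ := Finsupp.ne_iff.1 hm0
  have hmj : (m.mapDomain Subtype.val) j.1 ≠ 0 := by
    rwa [Finsupp.mapDomain_apply Subtype.val_injective]
  have hle := Finsupp.le_weight_of_ne_zero' d hmj
  have hpos := hd j.1
  omega

theorem isMonicIn_of_coeff_ne_zero (hd : ∀ j, 0 < d j) (hP : P.IsWeightedHomogeneous d n)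
    (h : coeff (Finsupp.single i k) P ≠ 0) : IsMonicIn i P := by
  have hk := mul_eq_of_coeff_single_ne_zero hP h
  have hC : (asPolynomialIn i P).coeff k = C (coeff (Finsupp.single i k) P) := by
    ext m
    rcases eq_or_ne m 0 with rfl | hm
    · rw [coeff_coeff_asPolynomialIn, coeff_zero_C, Finsupp.mapDomain_zero, add_zero]
    · rw [coeff_C, if_neg hm.symm]
      by_contra hne
      exact hm (eq_and_eq_zero_of_coeff_asPolynomialIn_ne_zero hd hP hk le_rfl hne).2
  have hdeg : (asPolynomialIn i P).natDegree = k := by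
    refine le_antisymm (Polynomial.natDegree_le_iff_coeff_eq_zero.2 fun k' hk' => ?_)
      (Polynomial.le_natDegree_of_ne_zero ?_)
    · ext m
      by_contra hne
      exact hk'.ne' (eq_and_eq_zero_of_coeff_asPolynomialIn_ne_zero hd hP hk hk'.le hne).1
    · rw [hC]
      simpa using h
  exact ⟨_, h, by rw [Polynomial.leadingCoeff, hdeg, hC]⟩

end Monic

/-! ### Degrees of a basic system -/

section Degrees

open MvPolynomial

theorem le_of_mem_vars_of_isWeightedHomogeneous {σ R : Type*} [CommSemiring R]
    {P : MvPolynomial σ R} {e : σ → ℕ} {n : ℕ} (hP : P.IsWeightedHomogeneous e n) {j : σ}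
    (hj : j ∈ P.vars) : e j ≤ n := by
  obtain ⟨m, hm, hmj⟩ := (mem_vars_iff_mem_support j).1 hj
  exact (Finsupp.le_weight_of_ne_zero' e (Finsupp.mem_support_iff.1 hmj)).trans
    (hP (mem_support_iff.1 hm)).le

theorem card_le_card_of_algebraicIndependent {K ι κ : Type*} [Field K] [Fintype ι] [Fintype κ]
    {P : ι → MvPolynomial κ K} (hP : AlgebraicIndependent K P) :
    Fintype.card ι ≤ Fintype.card κ := by
  have hcard := hP.lift_cardinalMk_le_trdeg
  rwa [MvPolynomial.trdeg_of_isDomain, Cardinal.lift_lift, Cardinal.mk_fintype,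
    Cardinal.mk_fintype, Cardinal.lift_natCast, Cardinal.lift_natCast, Nat.cast_le] at hcard

namespace IsBasicSystemWithDegrees

variable {W : Subgroup (V ≃ₗ[ℂ] V)} {f g : Fin (finrank ℂ V) → V → ℂ}
  {d e : Fin (finrank ℂ V) → ℕ}

/- Evaluating at `2 • v` multiplies `f i` by `2 ^ d i` and `P(f)` by `2 ^ n`; by algebraic
independence, comparing the two on each monomial of `P` gives its weight. -/
theorem isWeightedHomogeneous (hf : IsBasicSystemWithDegrees W d f)
    {P : MvPolynomial (Fin (finrank ℂ V)) ℂ} {n : ℕ}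
    (hP : aeval f P ∈ homogeneousFunctions V n) : P.IsWeightedHomogeneous d n := by
  have hscale : aeval (fun i => C (2 ^ d i) * X i : _ → MvPolynomial (Fin (finrank ℂ V)) ℂ) P =
      C (2 ^ n) * P := by
    refine hf.algebraicIndependent (funext fun v => ?_)
    rw [map_mul, Pi.mul_apply, aeval_pi_apply f (C _), algHom_C, Algebra.algebraMap_self,
      RingHom.id_apply, ← homogeneousFunctions_smul hP 2 v, aeval_pi_apply, aeval_pi_apply,
      ← AlgHom.comp_apply]
    congr 1
    ext i
    simp [homogeneousFunctions_smul (hf.homogeneous i)]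
  intro m hm
  have hcoeff := congrArg (coeff m) hscale
  rw [coeff_aeval_C_mul_X, coeff_C_mul] at hcoeff
  have hprod : (m.prod fun i k => ((2 : ℂ) ^ d i) ^ k) = 2 ^ Finsupp.weight d m := by
    simp only [Finsupp.prod, ← pow_mul, Finset.prod_pow_eq_pow_sum, Finsupp.weight_apply,
      Finsupp.sum, smul_eq_mul, mul_comm]
  have hpow : (2 : ℂ) ^ Finsupp.weight d m = 2 ^ n := hprod ▸ mul_right_cancel₀ hm hcoeff
  exact Nat.pow_right_injective le_rfl (by exact_mod_cast hpow)

theorem degree_pos (hf : IsBasicSystemWithDegrees W d f) (i) : 0 < d i := by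
  rw [Nat.pos_iff_ne_zero]
  intro h
  have hi := hf.homogeneous i
  rw [h, homogeneousFunctions, pow_zero, Submodule.mem_one] at hi
  obtain ⟨a, ha⟩ := hi
  have hX : (X i : MvPolynomial (Fin (finrank ℂ V)) ℂ) = C a :=
    hf.algebraicIndependent (by rw [aeval_X, ← ha, algHom_C])
  simpa using congrArg totalDegree hX

/- If `d k < e k`, then `f 0, …, f k` are polynomials in `g 0, …, g (k - 1)` only, which leaves no
room for their algebraic independence. -/
theorem degree_le (hf : IsBasicSystemWithDegrees W d f) (hg : IsBasicSystemWithDegrees W e g)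
    (k : Fin (finrank ℂ V)) : e k ≤ d k := by
  by_contra! hlt
  choose P hP using fun i => hg.exists_aeval_eq (hf.mem_invariants i)
  have hvars (i : {i // i ≤ k}) :
      ((P i.1).vars : Set (Fin (finrank ℂ V))) ⊆ Set.range (Subtype.val : {j // j < k} → _) := by
    intro j hj
    have hP_homogeneous : (P i.1).IsWeightedHomogeneous e (d i.1) :=
      hg.isWeightedHomogeneous (hP i.1 ▸ hf.homogeneous i.1)
    have hej : e j < e k := calc
      e j ≤ d i.1 := le_of_mem_vars_of_isWeightedHomogeneous hP_homogeneous hj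
      _ ≤ d k := hf.sorted i.2
      _ < e k := hlt
    exact ⟨⟨j, lt_of_not_ge fun hkj => hej.not_ge (hg.sorted hkj)⟩, rfl⟩
  choose Q hQ using fun i : {i // i ≤ k} =>
    exists_rename_eq_of_vars_subset_range (P i.1) _ Subtype.val_injective (hvars i)
  have hQ_independent : AlgebraicIndependent ℂ Q := by
    refine AlgebraicIndependent.of_comp ((aeval g).comp (rename Subtype.val)) ?_
    have hcomp : ((aeval g).comp (rename Subtype.val)) ∘ Q =
        f ∘ (Subtype.val : {i // i ≤ k} → _) := by
      ext1 i
      rw [Function.comp_apply, AlgHom.comp_apply, hQ, hP, Function.comp_apply]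
    rw [hcomp]
    exact hf.algebraicIndependent.comp _ Subtype.val_injective
  have hcard := card_le_card_of_algebraicIndependent hQ_independent
  rw [Fintype.card_subtype, Fintype.card_subtype, Finset.filter_ge_eq_Iic, Finset.filter_gt_eq_Iio,
    Fin.card_Iic, Fin.card_Iio] at hcard
  omega

theorem degrees_eq (hf : IsBasicSystemWithDegrees W d f) : degrees W = d := by
  have h : ∃ d, ∃ f, IsBasicSystemWithDegrees W d f := ⟨d, f, hf⟩
  rw [degrees, dif_pos h]
  obtain ⟨g, hg⟩ := h.choose_spec
  exact funext fun k => le_antisymm (hf.degree_le hg k) (hg.degree_le hf k)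

variable {l : Submodule ℂ V → Dual ℂ V}

theorem aeval_discriminant (hf : IsBasicSystemWithDegrees W d f) (hW : IsReflectionGroup W)
    (hl : IsChoiceOfForms W l) : aeval f (discriminant W l f) = discriminantFunction W l :=
  Function.invFun_eq (hf.exists_aeval_eq (discriminantFunction_mem_invariants hW hl))

theorem discriminant_isWeightedHomogeneous (hf : IsBasicSystemWithDegrees W d f)
    (hW : IsReflectionGroup W) (hl : IsChoiceOfForms W l) :
    (discriminant W l f).IsWeightedHomogeneous d (numReflections W + numHyperplanes W) := by
  have := hW.finite
  apply hf.isWeightedHomogeneous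
  rw [hf.aeval_discriminant hW hl]
  exact discriminantFunction_mem_homogeneousFunctions

end IsBasicSystemWithDegrees

end Degrees

/-! ### Regular numbers -/

section Eigenvectors

variable {K E : Type*} [Field K] [AddCommGroup E] [Module K E]

theorem pow_apply_eq_smul {w : E ≃ₗ[K] E} {ζ : K} {v : E} (h : w v = ζ • v) (n : ℕ) :
    (w ^ n) v = ζ ^ n • v := by
  induction n with
  | zero => simp
  | succ n ih => rw [pow_succ, LinearEquiv.mul_apply, h, map_smul, ih, smul_smul, pow_succ']

/- The eigenvector is the average of a vector `y` with `m y ≠ 0` under the powers of `ζ⁻¹ • w`. -/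
theorem exists_apply_eq_smul_apply_ne_zero {w : End K E} {ζ : K} {n : ℕ} (hn : (n : K) ≠ 0)
    (hw : w ^ n = 1) (hζ : ζ ^ n = 1) {m : Dual K E} (hm : m ≠ 0)
    (hmw : ∀ x, m (w x) = ζ * m x) : ∃ x, w x = ζ • x ∧ m x ≠ 0 := by
  have hζ0 : ζ ≠ 0 := by
    rintro rfl
    rw [zero_pow (by rintro rfl; exact hn Nat.cast_zero)] at hζ
    exact zero_ne_one hζ
  obtain ⟨y, hy⟩ := DFunLike.ne_iff.1 hm
  set u : End K E := ζ⁻¹ • w with hu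
  have hu_pow : u ^ n = 1 := by rw [hu, smul_pow, hw, inv_pow, hζ, inv_one, one_smul]
  have hmu (k : ℕ) : m ((u ^ k) y) = m y := by
    induction k with
    | zero => rw [pow_zero, End.one_apply]
    | succ k ih =>
      rw [pow_succ', End.mul_apply, hu, LinearMap.smul_apply, map_smul, hmw, smul_eq_mul,
        inv_mul_cancel_left₀ hζ0, ih]
  refine ⟨(∑ k ∈ Finset.range n, u ^ k) y, ?_, ?_⟩
  · have hfix : (u - 1) ((∑ k ∈ Finset.range n, u ^ k) y) = 0 := by
      rw [← End.mul_apply, mul_geom_sum, hu_pow, sub_self, LinearMap.zero_apply]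
    rw [LinearMap.sub_apply, sub_eq_zero, hu, LinearMap.smul_apply, End.one_apply] at hfix
    exact (inv_smul_eq_iff₀ hζ0).1 hfix
  · simpa [LinearMap.sum_apply, map_sum, hmu, hn] using hy

end Eigenvectors

theorem exists_apply_add_smul_ne_zero {g h : V → ℂ} (hg : g ∈ polynomialFunctions V)
    (hh : h ∈ polynomialFunctions V) {v x : V} (hgv : differential g v x ≠ 0) (hhv : h v ≠ 0) :
    ∃ t : ℂ, g (v + t • x) ≠ 0 ∧ h (v + t • x) ≠ 0 := by
  have hg_ne := HasDerivAt.eventually_ne (hasLineDerivAt_differential hg v x) hgv (c := 0)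
  have hh_ne := (HasDerivAt.continuousAt (hasLineDerivAt_differential hh v x)).eventually_ne
    (y := 0) (by rwa [zero_smul, add_zero])
  exact (hg_ne.and (hh_ne.filter_mono nhdsWithin_le_nhds)).exists

namespace IsBasicSystemWithDegrees

open MvPolynomial

variable {W : Subgroup (V ≃ₗ[ℂ] V)} {f : Fin (finrank ℂ V) → V → ℂ}
  {d : Fin (finrank ℂ V) → ℕ} {i : Fin (finrank ℂ V)} {l : Submodule ℂ V → Dual ℂ V}

theorem orderOf_eq [FiniteDimensional ℂ V] [Finite W] (hf : IsBasicSystemWithDegrees W d f)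
    {w : V ≃ₗ[ℂ] V} (hw : w ∈ W) {ζ : ℂ} {v : V} (hv : v ∈ regularVectors W) (hv0 : v ≠ 0)
    (hwv : w v = ζ • v) : orderOf w = orderOf ζ := by
  rw [orderOf_eq_orderOf_iff]
  intro n
  have hn := pow_apply_eq_smul hwv n
  constructor
  · intro hw_pow
    rw [hw_pow] at hn
    exact smul_left_injective ℂ hv0 (by simpa using hn.symm)
  · intro hζ_pow
    exact hf.eq_one_of_apply_eq hv (pow_mem hw n) (by rw [hn, hζ_pow, one_smul])

/- The vector `0` is regular when there are no hyperplanes; its eigenvalues are arbitrary, so `ζ`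
and the eigenvector have to be changed in that case. -/
theorem exists_eigenvector_of_isRegularNumber [FiniteDimensional ℂ V] [Finite W] [Nontrivial V]
    (hf : IsBasicSystemWithDegrees W d f) {n : ℕ} (h : IsRegularNumber W n) :
    ∃ w ∈ W, ∃ ζ : ℂ, orderOf w = n ∧ orderOf ζ = n ∧ ∃ v ∈ regularVectors W, w v = ζ • v := by
  obtain ⟨w, hw, ⟨ζ, -, v, hv, hwv⟩, hn⟩ := h
  rcases eq_or_ne v 0 with rfl | hv0
  · obtain ⟨u, -⟩ := exists_ne (0 : V)
    have hw1 : w = 1 := hf.eq_one_of_apply_eq hv hw (map_zero w)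
    refine ⟨w, hw, 1, hn, by rw [← hn, hw1, orderOf_one, orderOf_one], u,
      fun H hH => absurd H.zero_mem (hv H hH), ?_⟩
    rw [hw1, one_smul, LinearEquiv.coe_one, id]
  · exact ⟨w, hw, ζ, hn, by rw [← hn, hf.orderOf_eq hw hv hv0 hwv], v, hv, hwv⟩

theorem apply_eq_zero (hf : IsBasicSystemWithDegrees W d f) {w : V ≃ₗ[ℂ] V}
    (hw : w ∈ W) {ζ : ℂ} {v : V} (hwv : w v = ζ • v) {j} (hj : ¬ orderOf ζ ∣ d j) : f j v = 0 := by
  have hfv := (hf.mem_invariants j).2 w hw v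
  rw [hwv, homogeneousFunctions_smul (hf.homogeneous j)] at hfv
  by_contra hne
  exact hj (orderOf_dvd_of_pow_eq_one (mul_right_cancel₀ hne (hfv.trans (one_mul _).symm)))

theorem aeval_discriminant_apply (hf : IsBasicSystemWithDegrees W d f) (hW : IsReflectionGroup W)
    (hl : IsChoiceOfForms W l) (v : V) :
    aeval (fun j => f j v) (discriminant W l f) = discriminantFunction W l v := by
  rw [← hf.aeval_discriminant hW hl, aeval_pi_apply]

theorem exists_regular_apply_eq_piSingle [FiniteDimensional ℂ V]
    (hf : IsBasicSystemWithDegrees W d f) (hW : IsReflectionGroup W) (hl : IsChoiceOfForms W l)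
    (h : IsMonicIn i (discriminant W l f)) :
    ∃ v ∈ regularVectors W, (fun j => f j v) = Pi.single i 1 := by
  have := hW.finite
  have hhom := hf.discriminant_isWeightedHomogeneous hW hl
  obtain ⟨v, hv⟩ := hf.exists_apply_eq (Pi.single i 1)
  refine ⟨v, (discriminantFunction_ne_zero_iff hl).1 ?_, funext hv⟩
  rw [← hf.aeval_discriminant_apply hW hl, funext hv,
    aeval_piSingle_of_isWeightedHomogeneous (hf.degree_pos i) hhom
      (mul_eq_of_coeff_single_ne_zero hhom h.coeff_ne_zero), one_pow, mul_one]
  exact h.coeff_ne_zero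

/- Let `v` be regular with `f i v = 1` and `f j v = 0` for `j ≠ i`. Then `v` and `ζ • v`, with `ζ`
of order `d i`, have the same image under `f`, hence are conjugate under `W`. -/
theorem isRegularNumber_of_isMonicIn [FiniteDimensional ℂ V]
    (hf : IsBasicSystemWithDegrees W d f) (hW : IsReflectionGroup W) (hl : IsChoiceOfForms W l)
    (h : IsMonicIn i (discriminant W l f)) : IsRegularNumber W (d i) := by
  have := hW.finite
  obtain ⟨v, hv, hfv⟩ := hf.exists_regular_apply_eq_piSingle hW hl h
  have hv0 : v ≠ 0 := by
    rintro rfl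
    have hzero := homogeneousFunctions_smul (hf.homogeneous i) 0 0
    rw [smul_zero, zero_pow (hf.degree_pos i).ne', zero_mul, congrFun hfv i, Pi.single_eq_same]
      at hzero
    exact one_ne_zero hzero
  have hζ := Complex.isPrimitiveRoot_exp (d i) (hf.degree_pos i).ne'
  set ζ := Complex.exp (2 * Real.pi * Complex.I / d i)
  obtain ⟨w, hw, hwv⟩ := hf.exists_mem_apply_eq (v := v) (v' := ζ • v) fun j => by
    rw [homogeneousFunctions_smul (hf.homogeneous j), congrFun hfv j]
    rcases eq_or_ne j i with rfl | hj
    · rw [hζ.pow_eq_one, one_mul]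
    · rw [Pi.single_eq_of_ne hj, mul_zero]
  exact ⟨w, hw, ⟨ζ, isOfFinOrder_iff_pow_eq_one.2 ⟨d i, hf.degree_pos i, hζ.pow_eq_one⟩,
    v, hv, hwv⟩, by rw [hf.orderOf_eq hw hv hv0 hwv, hζ.eq_orderOf]⟩

theorem isMonicIn_of_forall_apply_eq_zero (hf : IsBasicSystemWithDegrees W d f)
    (hW : IsReflectionGroup W) (hl : IsChoiceOfForms W l) {v : V} (hv : v ∈ regularVectors W)
    (h : ∀ j, j ≠ i → f j v = 0) : IsMonicIn i (discriminant W l f) := by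
  have := hW.finite
  have hfv : (fun j => f j v) = Pi.single i (f i v) := by
    ext j
    rcases eq_or_ne j i with rfl | hj
    · rw [Pi.single_eq_same]
    · rw [h j hj, Pi.single_eq_of_ne hj]
  have hdisc := (discriminantFunction_ne_zero_iff hl).2 hv
  rw [← hf.aeval_discriminant_apply hW hl, hfv] at hdisc
  obtain ⟨k, hk⟩ := exists_coeff_single_ne_zero hdisc
  exact isMonicIn_of_coeff_ne_zero hf.degree_pos
    (hf.discriminant_isWeightedHomogeneous hW hl) hk

theorem changeOfVariables (hf : IsBasicSystemWithDegrees W d f)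
    {θ η : Fin (finrank ℂ V) → MvPolynomial (Fin (finrank ℂ V)) ℂ}
    (hθη : ∀ j, aeval θ (η j) = X j) (hηθ : ∀ j, aeval η (θ j) = X j)
    (hhom : ∀ j, aeval f (θ j) ∈ homogeneousFunctions V (d j)) :
    IsBasicSystemWithDegrees W d fun j => aeval f (θ j) := by
  have hcomp : aeval (fun j => aeval f (θ j)) = (aeval f).comp (aeval θ) := by
    ext1 j
    simp
  have hθη' (P) : aeval θ (aeval η P) = P := by
    rw [comp_aeval_apply, funext hθη, aeval_X_left_apply]
  have hηθ' (P) : aeval η (aeval θ P) = P := by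
    rw [comp_aeval_apply, funext hηθ, aeval_X_left_apply]
  refine ⟨?_, ?_, hhom, hf.sorted⟩
  · rw [AlgebraicIndependent, hcomp, AlgHom.coe_comp]
    exact Function.Injective.comp hf.algebraicIndependent (Function.LeftInverse.injective hηθ')
  · rw [← hf.adjoin_eq, Algebra.adjoin_range_eq_range_aeval, Algebra.adjoin_range_eq_range_aeval,
      hcomp]
    rw [AlgHom.range_comp,
      (AlgHom.range_eq_top _).2 (Function.RightInverse.surjective hθη'), Algebra.map_top]

theorem sub_smul_pow (hf : IsBasicSystemWithDegrees W d f) {c : Fin (finrank ℂ V) → ℂ}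
    {n : Fin (finrank ℂ V) → ℕ} (hci : c i = 0) (hcn : ∀ j, c j ≠ 0 → d i * n j = d j) :
    IsBasicSystemWithDegrees W d fun j => f j - c j • f i ^ n j := by
  let θ (s : ℂ) (j : Fin (finrank ℂ V)) : MvPolynomial (Fin (finrank ℂ V)) ℂ :=
    X j - C (s * c j) * X i ^ n j
  have hθi (s : ℂ) : θ s i = X i := by simp [θ, hci]
  have hinverse (s : ℂ) (j) : aeval (θ s) (θ (-s) j) = X j := by
    have hsubst : aeval (θ s) (θ (-s) j) = θ s j - C (-s * c j) * θ s i ^ n j := by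
      simp [θ, algebraMap_eq]
    rw [hsubst, hθi]
    simp [θ]
  have happ (j) : aeval f (θ 1 j) = f j - c j • f i ^ n j := by
    ext x
    simp [θ, Algebra.smul_def]
  simp only [← happ]
  refine hf.changeOfVariables (η := θ (-1)) (hinverse 1) (by simpa using hinverse (-1)) fun j => ?_
  rw [happ]
  refine sub_mem (hf.homogeneous j) ?_
  rcases eq_or_ne (c j) 0 with hcj | hcj
  · rw [hcj, zero_smul]
    exact zero_mem _
  · have hpow := Submodule.pow_mem_pow _ (hf.homogeneous i) (n j)
    rw [homogeneousFunctions, ← pow_mul, hcn j hcj] at hpow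
    exact Submodule.smul_mem _ _ hpow

theorem exists_forall_apply_eq_zero (hf : IsBasicSystemWithDegrees W d f) {v : V}
    (hi : f i v ≠ 0) (hv : ∀ j, ¬ d i ∣ d j → f j v = 0) :
    ∃ g, IsBasicSystemWithDegrees W d g ∧ ∀ j, j ≠ i → g j v = 0 := by
  classical
  let c (j : Fin (finrank ℂ V)) : ℂ := if j = i then 0 else f j v / f i v ^ (d j / d i)
  refine ⟨_, hf.sub_smul_pow (c := c) (n := fun j => d j / d i) (if_pos rfl) fun j hj => ?_,
    fun j hj => ?_⟩
  · refine Nat.mul_div_cancel' ?_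
    by_contra hdvd
    exact hj (by simp [c, hv j hdvd])
  · simp [c, hj, pow_ne_zero _ hi]

theorem differential_apply_of_eigenvector (hf : IsBasicSystemWithDegrees W d f) {w : V ≃ₗ[ℂ] V}
    (hw : w ∈ W) {ζ : ℂ} (hζ : ζ ^ d i = 1) {v : V} (hwv : w v = ζ • v) (x : V) :
    differential (f i) v (w x) = ζ * differential (f i) v x := by
  have hinv := hf.mem_invariants i
  have hscale : (fun y => f i ((ζ • LinearMap.id : V →ₗ[ℂ] V) y)) = f i := funext fun y => by
    rw [LinearMap.smul_apply, LinearMap.id_apply, homogeneousFunctions_smul (hf.homogeneous i),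
      hζ, one_mul]
  have hdiff := differential_comp hinv.1 (ζ • LinearMap.id) v
  rw [hscale] at hdiff
  calc differential (f i) v (w x)
      = differential (f i) (w v) (ζ • w x) := by
        rw [hwv]
        exact LinearMap.congr_fun hdiff (w x)
    _ = ζ * differential (f i) v x := by
        rw [map_smul, differential_apply_of_mem_invariants hinv hw, smul_eq_mul]

/- The differential of `f i` at `v` is a nonzero eigenvector of `w`, so that `f i` is not constant
on some line `v + t • x` inside the `ζ`-eigenspace. -/
theorem exists_regular_apply_ne_zero [FiniteDimensional ℂ V] [Finite W]
    (hf : IsBasicSystemWithDegrees W d f) (hl : IsChoiceOfForms W l) {w : V ≃ₗ[ℂ] V} (hw : w ∈ W)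
    (hwd : w ^ d i = 1) {ζ : ℂ} (hζ : ζ ^ d i = 1) {v : V} (hv : v ∈ regularVectors W)
    (hwv : w v = ζ • v) : ∃ u ∈ regularVectors W, w u = ζ • u ∧ f i u ≠ 0 := by
  obtain ⟨x, hwx, hx⟩ := exists_apply_eq_smul_apply_ne_zero (w := (w : End ℂ V))
    (Nat.cast_ne_zero.2 (hf.degree_pos i).ne')
    ((map_pow LinearEquiv.automorphismGroup.toLinearMapMonoidHom w _).symm.trans
      (congrArg LinearEquiv.automorphismGroup.toLinearMapMonoidHom hwd)) hζ
    (hf.differential_ne_zero hv i) (hf.differential_apply_of_eigenvector hw hζ hwv)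
  obtain ⟨t, hft, hDt⟩ := exists_apply_add_smul_ne_zero (hf.mem_invariants i).1
    (homogeneousFunctions_le _ discriminantFunction_mem_homogeneousFunctions) hx
    ((discriminantFunction_ne_zero_iff hl).2 hv)
  have hwx' : w x = ζ • x := hwx
  exact ⟨v + t • x, (discriminantFunction_ne_zero_iff hl).1 hDt, by
    rw [map_add, map_smul, hwv, hwx', smul_add, smul_comm], hft⟩

theorem exists_isMonicIn_of_isRegularNumber [FiniteDimensional ℂ V]
    (hf : IsBasicSystemWithDegrees W d f) (hW : IsReflectionGroup W) (hl : IsChoiceOfForms W l)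
    (h : IsRegularNumber W (d i)) :
    ∃ g, IsSystemOfBasicInvariants W g ∧ IsMonicIn i (discriminant W l g) := by
  have := hW.finite
  have : Nontrivial V := Module.nontrivial_of_finrank_pos (R := ℂ) i.pos
  obtain ⟨w, hw, ζ, hwd, hζd, v, hv, hwv⟩ := hf.exists_eigenvector_of_isRegularNumber h
  obtain ⟨u, hu, hwu, hfu⟩ := hf.exists_regular_apply_ne_zero hl hw (hwd ▸ pow_orderOf_eq_one w)
    (hζd ▸ pow_orderOf_eq_one ζ) hv hwv
  obtain ⟨g, hg, hgu⟩ := hf.exists_forall_apply_eq_zero hfu fun j hj =>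
    hf.apply_eq_zero hw hwu (hζd ▸ hj)
  exact ⟨g, ⟨d, hg⟩, hg.isMonicIn_of_forall_apply_eq_zero hW hl hu hgu⟩

theorem isMonicIn_of_isRegularNumber [FiniteDimensional ℂ V]
    (hf : IsBasicSystemWithDegrees W d f) (hW : IsReflectionGroup W) (hl : IsChoiceOfForms W l)
    (h : IsRegularNumber W (d i)) (hi : ∀ j, d i ∣ d j → j = i) :
    IsMonicIn i (discriminant W l f) := by
  have := hW.finite
  have : Nontrivial V := Module.nontrivial_of_finrank_pos (R := ℂ) i.pos
  obtain ⟨w, hw, ζ, -, hζd, v, hv, hwv⟩ := hf.exists_eigenvector_of_isRegularNumber h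
  exact hf.isMonicIn_of_forall_apply_eq_zero hW hl hv fun j hj =>
    hf.apply_eq_zero hw hwv (hζd ▸ fun hdvd => hj (hi j hdvd))

end IsBasicSystemWithDegrees

/-! ### Finite groups generated by pseudo-reflections acting on a polynomial ring -/

section Chevalley

open MvPolynomial

theorem exists_subset_span_image_eq_and_minimal {R M ι : Type*} [Semiring R] [AddCommMonoid M]
    [Module R M] (h : ι → M) (s : Finset ι) :
    ∃ t ⊆ s, Submodule.span R (h '' t) = Submodule.span R (h '' s) ∧
      ∀ k ∈ t, h k ∉ Submodule.span R (h '' (t \ {k})) := by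
  classical
  obtain ⟨t, hts, ht⟩ := exists_minimal_le_of_wellFoundedLT
    (fun t : Finset ι => Submodule.span R (h '' t) = Submodule.span R (h '' s)) s rfl
  refine ⟨t, hts, ht.prop, fun k hk hmem => ?_⟩
  rw [← Finset.coe_erase] at hmem
  have hspan : Submodule.span R (h '' (t.erase k)) = Submodule.span R (h '' s) := by
    rw [← ht.prop, ← Submodule.span_insert_eq_span hmem, ← Set.image_insert_eq,
      ← Finset.coe_insert, Finset.insert_erase hk]
  exact Finset.notMem_erase k t (ht.le_of_le hspan (Finset.erase_subset k t) hk)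

theorem homogeneousComponent_mul_of_isHomogeneous {R σ : Type*} [CommSemiring R]
    (a : MvPolynomial σ R) {x : MvPolynomial σ R} {e : ℕ} (hx : x.IsHomogeneous e) (n : ℕ) :
    homogeneousComponent n (a * x) =
      if e ≤ n then homogeneousComponent (n - e) a * x else 0 := by
  let _ : GradedAlgebra (homogeneousSubmodule σ R) := MvPolynomial.gradedAlgebra
  have hdecompose (p : MvPolynomial σ R) (m : ℕ) :
      (DirectSum.decompose (homogeneousSubmodule σ R) p m : MvPolynomial σ R) =
        homogeneousComponent m p := decomposition.decompose'_apply p m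
  have hmul := DirectSum.coe_decompose_mul_of_right_mem (homogeneousSubmodule σ R) n (a := a)
    ((mem_homogeneousSubmodule e x).2 hx)
  rwa [hdecompose, hdecompose] at hmul

theorem homogeneousComponent_sum_mul {R σ ι : Type*} [CommSemiring R] {f : ι → MvPolynomial σ R}
    {d : ι → ℕ} (hf : ∀ i, (f i).IsHomogeneous (d i)) (s : Finset ι) (b : ι → MvPolynomial σ R)
    (n : ℕ) : homogeneousComponent n (∑ i ∈ s, b i * f i) =
      ∑ i ∈ s, if d i ≤ n then homogeneousComponent (n - d i) (b i) * f i else 0 := by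
  rw [map_sum]
  exact Finset.sum_congr rfl fun i _ => homogeneousComponent_mul_of_isHomogeneous _ (hf i) n

theorem mem_span_image_diff_singleton {K σ ι : Type*} [Field K] {f : ι → MvPolynomial σ K}
    {d : ι → ℕ} (hf : ∀ i, (f i).IsHomogeneous (d i)) {s : Finset ι} {b : ι → MvPolynomial σ K}
    (hb : ∑ i ∈ s, b i * f i = 0) {k : ι} (hk : k ∈ s) (hbk : constantCoeff (b k) ≠ 0) :
    f k ∈ Ideal.span (f '' (s \ {k})) := by
  classical
  have hcomponent := homogeneousComponent_sum_mul hf s b (d k)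
  rw [hb, map_zero, ← Finset.add_sum_erase s _ hk, if_pos le_rfl, Nat.sub_self,
    homogeneousComponent_zero, ← constantCoeff_eq] at hcomponent
  have hmem : C (constantCoeff (b k)) * f k ∈ Ideal.span (f '' (s \ {k})) := by
    rw [eq_neg_of_add_eq_zero_left hcomponent.symm]
    refine neg_mem (sum_mem fun i hi => ?_)
    split_ifs
    · exact Ideal.mul_mem_left _ _ (Ideal.subset_span ⟨i, by simpa [and_comm] using hi, rfl⟩)
    · exact zero_mem _
  have hunit : IsUnit (C (σ := σ) (constantCoeff (b k))) := hbk.isUnit.map C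
  exact (Ideal.unit_mul_mem_iff_mem _ hunit).1 hmem

theorem derivation_aeval {R A M ι : Type*} [CommSemiring R] [CommSemiring A] [Algebra R A]
    [AddCommMonoid M] [Module A M] [Module R M] [Fintype ι] (D : Derivation R A M) (f : ι → A)
    (P : MvPolynomial ι R) : D (aeval f P) = ∑ i, aeval f (pderiv i P) • D (f i) := by
  classical
  induction P using MvPolynomial.induction_on with
  | C a => simp
  | add p q hp hq => simp only [map_add, hp, hq, add_smul, Finset.sum_add_distrib]
  | mul_X p j hp =>
    have hsingle :
        ∑ i, aeval f (Pi.single (M := fun _ => MvPolynomial ι R) i 1 j) • D (f i) = D (f j) := by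
      rw [Finset.sum_eq_single_of_mem j (Finset.mem_univ j) fun i _ hij => by
        rw [Pi.single_eq_of_ne' hij, map_zero, zero_smul], Pi.single_eq_same, map_one, one_smul]
    simp only [map_mul, aeval_X, Derivation.leibniz, hp, pderiv_X, map_add, smul_eq_mul, add_smul,
      mul_smul, Finset.sum_add_distrib, ← Finset.smul_sum, hsingle]

section WeightedHomogeneous

variable {R σ ι : Type*} [CommSemiring R] {f : ι → MvPolynomial σ R} {d : ι → ℕ}

theorem aeval_isHomogeneous_of_isWeightedHomogeneous (hf : ∀ i, (f i).IsHomogeneous (d i))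
    {P : MvPolynomial ι R} {n : ℕ} (hP : P.IsWeightedHomogeneous d n) :
    (aeval f P).IsHomogeneous n := by
  rw [aeval_def, eval₂_eq]
  refine IsHomogeneous.sum _ _ _ fun m hm => ?_
  rw [algebraMap_eq]
  refine IsHomogeneous.C_mul ?_ _
  rw [← hP (mem_support_iff.1 hm), Finsupp.weight_apply]
  refine IsHomogeneous.prod _ _ _ fun i _ => ?_
  simpa only [smul_eq_mul, mul_comm] using (hf i).pow (m i)

theorem homogeneousComponent_aeval (hf : ∀ i, (f i).IsHomogeneous (d i)) (n : ℕ)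
    (P : MvPolynomial ι R) :
    homogeneousComponent n (aeval f P) = aeval f (weightedHomogeneousComponent d n P) := by
  classical
  induction P using MvPolynomial.induction_on' with
  | monomial m a =>
    have hm := isWeightedHomogeneous_monomial d m a rfl
    rw [homogeneousComponent_of_mem (aeval_isHomogeneous_of_isWeightedHomogeneous hf hm),
      weightedHomogeneousComponent_of_mem hm]
    split_ifs
    · rfl
    · rw [map_zero]
  | add p q hp hq => rw [map_add, map_add, hp, hq, map_add, map_add]

theorem pderiv_isWeightedHomogeneous {P : MvPolynomial ι R} {n : ℕ}
    (hP : P.IsWeightedHomogeneous d n) (i : ι) :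
    (pderiv i P).IsWeightedHomogeneous d (n - d i) := by
  by_cases hi : i ∈ P.vars
  · exact hP.pderiv (Nat.sub_add_cancel (le_of_mem_vars_of_isWeightedHomogeneous hP hi))
  · rw [pderiv_eq_zero_of_notMem_vars hi]
    exact isWeightedHomogeneous_zero _ _ _

theorem exists_pderiv_ne_zero [NoZeroDivisors R] [CharZero R] {P : MvPolynomial ι R} {n : ℕ}
    [Finite ι] (hP : P.IsWeightedHomogeneous d n) (hn : n ≠ 0) (hP0 : P ≠ 0) :
    ∃ i, pderiv i P ≠ 0 := by
  have := Fintype.ofFinite ι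
  by_contra! h
  have heuler := hP.sum_weight_X_mul_pderiv
  simp only [h, mul_zero, smul_zero, Finset.sum_const_zero] at heuler
  rw [nsmul_eq_mul] at heuler
  exact mul_ne_zero (Nat.cast_ne_zero.2 hn) hP0 heuler.symm

end WeightedHomogeneous

section Relations

variable {R σ ι : Type*} [CommRing R] {f : ι → MvPolynomial σ R} {d : ι → ℕ}

theorem exists_isWeightedHomogeneous_aeval_eq_zero (hf : ∀ i, (f i).IsHomogeneous (d i))
    (hind : ¬ AlgebraicIndependent R f) :
    ∃ n, ∃ P : MvPolynomial ι R, P.IsWeightedHomogeneous d n ∧ P ≠ 0 ∧ aeval f P = 0 := by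
  rw [algebraicIndependent_iff] at hind
  push Not at hind
  obtain ⟨P, hP, hP0⟩ := hind
  obtain ⟨n, hn⟩ : ∃ n, weightedHomogeneousComponent d n P ≠ 0 := by
    by_contra! h
    exact hP0 (by rw [← finsum_weightedHomogeneousComponent d P, funext h, finsum_zero])
  exact ⟨n, _, weightedHomogeneousComponent_isWeightedHomogeneous n P, hn,
    by rw [← homogeneousComponent_aeval hf, hP, map_zero]⟩

/- Differentiate a relation `P(f) = 0` of minimal weight: some `∂ᵢP` is nonzero, and by minimality
so is `(∂ᵢP)(f)`. -/
theorem exists_sum_mul_pderiv_eq_zero [IsDomain R] [CharZero R] [Fintype ι] (hd : ∀ i, 0 < d i)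
    (hf : ∀ i, (f i).IsHomogeneous (d i)) (hind : ¬ AlgebraicIndependent R f) :
    ∃ Q : ι → MvPolynomial ι R, ∃ e : ι → ℕ, (∀ i, (aeval f (Q i)).IsHomogeneous (e i)) ∧
      (∃ i, aeval f (Q i) ≠ 0) ∧ ∀ k, ∑ i, aeval f (Q i) * pderiv k (f i) = 0 := by
  classical
  have hex := exists_isWeightedHomogeneous_aeval_eq_zero hf hind
  obtain ⟨P, hP, hP0, hPf⟩ := Nat.find_spec hex
  have hn : Nat.find hex ≠ 0 := by
    intro hn
    rw [hn] at hP
    have hC := weightedHomogeneousComponent_zero P fun i => (hd i).ne'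
    rw [hP.weightedHomogeneousComponent_same] at hC
    rw [hC, algHom_C, algebraMap_eq, C_eq_zero] at hPf
    exact hP0 (by rw [hC, hPf, C_0])
  obtain ⟨i, hi⟩ := exists_pderiv_ne_zero hP hn hP0
  have hQ := pderiv_isWeightedHomogeneous hP
  refine ⟨fun i => pderiv i P, fun i => Nat.find hex - d i,
    fun i => aeval_isHomogeneous_of_isWeightedHomogeneous hf (hQ i), ⟨i, fun h => ?_⟩, fun k => ?_⟩
  · exact Nat.find_min hex (Nat.sub_lt (Nat.pos_of_ne_zero hn) (hd i)) ⟨_, hQ i, hi, h⟩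
  · rw [← map_zero (pderiv k), ← hPf, derivation_aeval]
    rfl

end Relations

variable {K σ G : Type*} [Field K] [Group G] [MulSemiringAction G (MvPolynomial σ K)]

variable (K σ) in
/-- An element of a group acting on a polynomial ring is a pseudo-reflection if it acts trivially
modulo a nonzero linear form; for the action of `GL(V)` on the polynomial functions on `V` this
covers the reflections of `V` and the identity. -/
def IsPseudoReflection (t : G) : Prop :=
  ∃ l : MvPolynomial σ K, l.IsHomogeneous 1 ∧ l ≠ 0 ∧ ∀ p : MvPolynomial σ K, l ∣ t • p - p

variable (K σ G) in
/-- The action of `G` on the polynomial ring preserves the homogeneous polynomials of each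
degree. -/
def IsDegreePreserving : Prop :=
  ∀ (g : G) (n : ℕ) (p : MvPolynomial σ K), p.IsHomogeneous n → (g • p).IsHomogeneous n

theorem IsDegreePreserving.totalDegree_smul_le (hG : IsDegreePreserving K σ G) (g : G)
    (p : MvPolynomial σ K) : (g • p).totalDegree ≤ p.totalDegree := by
  conv_lhs => rw [← sum_homogeneousComponent p, Finset.smul_sum]
  refine totalDegree_finsetSum_le fun m hm => ?_
  exact (hG g m _ (homogeneousComponent_isHomogeneous m p)).totalDegree_le.trans
    (Nat.lt_succ_iff.1 (Finset.mem_range.1 hm))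

theorem IsDegreePreserving.totalDegree_lt_of_smul_sub_eq_mul (hG : IsDegreePreserving K σ G)
    {t : G} {l p q : MvPolynomial σ K} (hl : l.IsHomogeneous 1) (hl0 : l ≠ 0) (hq : q ≠ 0)
    (h : t • p - p = l * q) : q.totalDegree < p.totalDegree := by
  have hmul : (l * q).totalDegree = 1 + q.totalDegree := by
    rw [totalDegree_mul_of_isDomain hl0 hq, hl.totalDegree hl0]
  have hle : (t • p - p).totalDegree ≤ p.totalDegree :=
    (totalDegree_sub _ _).trans (max_le (hG.totalDegree_smul_le t p) le_rfl)
  rw [h, hmul] at hle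
  omega

theorem IsDegreePreserving.homogeneousComponent_smul (hG : IsDegreePreserving K σ G) (g : G)
    (n : ℕ) (p : MvPolynomial σ K) :
    homogeneousComponent n (g • p) = g • homogeneousComponent n p := by
  conv_lhs => rw [← sum_homogeneousComponent p, Finset.smul_sum, map_sum]
  rw [Finset.sum_congr rfl fun m _ => homogeneousComponent_of_mem
    ((mem_homogeneousSubmodule m _).2 (hG g m _ (homogeneousComponent_isHomogeneous m p))),
    Finset.sum_ite_eq]
  split_ifs with h
  · rfl
  · rw [homogeneousComponent_eq_zero _ _ (by simpa using h), smul_zero]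

variable (K σ G) in
/-- The algebra of invariants in a polynomial ring. -/
abbrev fixedPolynomials [SMulCommClass G K (MvPolynomial σ K)] :
    Subalgebra K (MvPolynomial σ K) :=
  FixedPoints.subalgebra K (MvPolynomial σ K) G

section Reynolds

variable [Fintype G]

variable (G) in
/-- The Reynolds operator, averaging polynomials over the group. It is meaningful when the order of
`G` is invertible in `K`, and is `0` otherwise. -/
def reynolds (p : MvPolynomial σ K) : MvPolynomial σ K :=
  (Nat.card G : K)⁻¹ • ∑ g : G, g • p

theorem reynolds_sub_self [NeZero (Nat.card G : K)] (p : MvPolynomial σ K) :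
    reynolds G p - p = (Nat.card G : K)⁻¹ • ∑ g : G, (g • p - p) := by
  rw [Finset.sum_sub_distrib, smul_sub, Finset.sum_const, Finset.card_univ,
    ← Nat.card_eq_fintype_card, ← Nat.cast_smul_eq_nsmul K, inv_smul_smul₀ (NeZero.ne _), reynolds]

variable [SMulCommClass G K (MvPolynomial σ K)]

theorem reynolds_mem_fixedPolynomials (p : MvPolynomial σ K) :
    reynolds G p ∈ fixedPolynomials K σ G := by
  intro h
  rw [reynolds, smul_comm, Finset.smul_sum]
  simp only [smul_smul]
  exact congrArg _ (Equiv.sum_comp (Equiv.mulLeft h) fun g => g • p)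

theorem reynolds_sum_mul_of_mem {ι : Type*} (s : Finset ι) (a : ι → MvPolynomial σ K)
    {x : ι → MvPolynomial σ K} (hx : ∀ i, x i ∈ fixedPolynomials K σ G) :
    reynolds G (∑ i ∈ s, a i * x i) = ∑ i ∈ s, reynolds G (a i) * x i := by
  simp only [reynolds, Finset.smul_sum, smul_mul', hx _ _, smul_mul_assoc, Finset.sum_mul]
  rw [Finset.sum_comm]

theorem reynolds_eq_self [NeZero (Nat.card G : K)] {p : MvPolynomial σ K}
    (hp : p ∈ fixedPolynomials K σ G) : reynolds G p = p := by
  rw [← sub_eq_zero, reynolds_sub_self, Finset.sum_eq_zero fun g _ => sub_eq_zero.2 (hp g),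
    smul_zero]

end Reynolds

section HilbertIdeal

variable [SMulCommClass G K (MvPolynomial σ K)]

variable (K σ G) in
/-- The ideal generated by the homogeneous invariants of positive degree. -/
def hilbertIdeal : Ideal (MvPolynomial σ K) :=
  Ideal.span {p | p ∈ fixedPolynomials K σ G ∧ ∃ n, 0 < n ∧ p.IsHomogeneous n}

theorem IsDegreePreserving.homogeneousComponent_mem_fixedPolynomials
    (hG : IsDegreePreserving K σ G) {p : MvPolynomial σ K} (hp : p ∈ fixedPolynomials K σ G)
    (n : ℕ) : homogeneousComponent n p ∈ fixedPolynomials K σ G :=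
  fun g => by rw [← hG.homogeneousComponent_smul, hp g]

theorem IsDegreePreserving.mem_hilbertIdeal (hG : IsDegreePreserving K σ G)
    {p : MvPolynomial σ K} (hp : p ∈ fixedPolynomials K σ G) (h0 : constantCoeff p = 0) :
    p ∈ hilbertIdeal K σ G := by
  rw [← sum_homogeneousComponent p]
  refine sum_mem fun n _ => ?_
  rcases Nat.eq_zero_or_pos n with rfl | hn
  · rw [homogeneousComponent_zero, ← constantCoeff_eq, h0, C_0]
    exact zero_mem _
  · exact Ideal.subset_span ⟨hG.homogeneousComponent_mem_fixedPolynomials hp n, n, hn,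
      homogeneousComponent_isHomogeneous n p⟩

theorem smul_mem_hilbertIdeal (g : G) {p : MvPolynomial σ K} (hp : p ∈ hilbertIdeal K σ G) :
    g • p ∈ hilbertIdeal K σ G := by
  suffices h : hilbertIdeal K σ G ≤
      (hilbertIdeal K σ G).comap (MulSemiringAction.toRingHom G (MvPolynomial σ K) g) from h hp
  refine Ideal.span_le.2 fun q hq => ?_
  rw [SetLike.mem_coe, Ideal.mem_comap, MulSemiringAction.toRingHom_apply, hq.1 g]
  exact Ideal.subset_span hq

theorem smul_sub_self_mem_hilbertIdeal {T : Set G} (hT : Subgroup.closure T = ⊤)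
    {p : MvPolynomial σ K} (h : ∀ t ∈ T, t • p - p ∈ hilbertIdeal K σ G) (g : G) :
    g • p - p ∈ hilbertIdeal K σ G := by
  have hg : g ∈ Subgroup.closure T := hT ▸ Subgroup.mem_top g
  induction hg using Subgroup.closure_induction with
  | mem t ht => exact h t ht
  | one => rw [one_smul, sub_self]; exact zero_mem _
  | mul a b _ _ ha hb =>
    rw [mul_smul, ← sub_add_sub_cancel _ (a • p), ← smul_sub]
    exact add_mem (smul_mem_hilbertIdeal a hb) ha
  | inv a _ ha =>
    have hinv : -(a⁻¹ • p - p) = a⁻¹ • (a • p - p) := by rw [neg_sub, smul_sub, inv_smul_smul]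
    rw [← neg_mem_iff, hinv]
    exact smul_mem_hilbertIdeal _ ha

variable {ι : Type*} {x u v : ι → MvPolynomial σ K} {e : ι → ℕ} {s : Finset ι} {k : ι}

theorem sum_mul_eq_zero_of_smul_sub_eq_mul (hx : ∀ i, x i ∈ fixedPolynomials K σ G)
    (hu : ∑ i ∈ s, u i * x i = 0) {t : G} {l : MvPolynomial σ K} (hl : l ≠ 0)
    (hv : ∀ i, t • u i - u i = l * v i) : ∑ i ∈ s, v i * x i = 0 := by
  refine (mul_eq_zero.1 ?_).resolve_left hl
  calc l * ∑ i ∈ s, v i * x i = t • ∑ i ∈ s, u i * x i - ∑ i ∈ s, u i * x i := by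
        simp only [Finset.mul_sum, Finset.smul_sum, smul_mul', hx _ t, ← mul_assoc, ← hv,
          ← Finset.sum_sub_distrib, sub_mul]
    _ = 0 := by rw [hu, smul_zero, sub_zero]

theorem IsDegreePreserving.reynolds_mem_hilbertIdeal [Fintype G] (hG : IsDegreePreserving K σ G)
    (hx : ∀ i, x i ∈ fixedPolynomials K σ G) (hxe : ∀ i, (x i).IsHomogeneous (e i)) (hk : k ∈ s)
    (hmin : x k ∉ Ideal.span (x '' (s \ {k}))) (hu : ∑ i ∈ s, u i * x i = 0) :
    reynolds G (u k) ∈ hilbertIdeal K σ G := by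
  refine hG.mem_hilbertIdeal (reynolds_mem_fixedPolynomials _) ?_
  by_contra h0
  refine hmin (mem_span_image_diff_singleton (b := fun i => reynolds G (u i)) hxe ?_ hk h0)
  rw [← reynolds_sum_mul_of_mem s u hx, hu, reynolds, Finset.sum_eq_zero fun g _ => smul_zero g,
    smul_zero]

/- Induction on the degree of `u k`: for a pseudo-reflection `t` with linear form `l`, the quotients
`(t • u i - u i) / l` satisfy the same relation, so `t • u k - u k` lies in the Hilbert ideal. Thus
`u k` is congruent to its average, which lies in the Hilbert ideal by minimality of `x k`. -/
theorem IsDegreePreserving.mem_hilbertIdeal_of_sum_mul_eq_zero [NeZero (Nat.card G : K)]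
    (hG : IsDegreePreserving K σ G) {T : Set G} (hT : Subgroup.closure T = ⊤)
    (hrefl : ∀ t ∈ T, IsPseudoReflection K σ t) (hx : ∀ i, x i ∈ fixedPolynomials K σ G)
    (hxe : ∀ i, (x i).IsHomogeneous (e i)) (hk : k ∈ s)
    (hmin : x k ∉ Ideal.span (x '' (s \ {k}))) (hu : ∑ i ∈ s, u i * x i = 0) :
    u k ∈ hilbertIdeal K σ G := by
  have := Nat.finite_of_card_ne_zero (NeZero.of_neZero_natCast K (n := Nat.card G)).out
  have := Fintype.ofFinite G
  induction hn : (u k).totalDegree using Nat.strong_induction_on generalizing u with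
  | _ n ih =>
  have hT_mem (t : G) (ht : t ∈ T) : t • u k - u k ∈ hilbertIdeal K σ G := by
    obtain ⟨l, hl, hl0, hdvd⟩ := hrefl t ht
    choose v hv using fun i => hdvd (u i)
    have hsum := sum_mul_eq_zero_of_smul_sub_eq_mul hx hu hl0 hv
    rw [hv k]
    refine Ideal.mul_mem_left _ _ ?_
    by_cases hvk : v k = 0
    · rw [hvk]
      exact zero_mem _
    · exact ih _ (hn ▸ hG.totalDegree_lt_of_smul_sub_eq_mul hl hl0 hvk (hv k)) hsum rfl
  have havg : reynolds G (u k) - u k ∈ hilbertIdeal K σ G := by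
    rw [reynolds_sub_self]
    exact Submodule.smul_of_tower_mem _ _
      (sum_mem fun g _ => smul_sub_self_mem_hilbertIdeal hT hT_mem g)
  rw [← sub_sub_cancel (reynolds G (u k)) (u k)]
  exact sub_mem (hG.reynolds_mem_hilbertIdeal hx hxe hk hmin hu) havg

end HilbertIdeal

section Generators

variable [SMulCommClass G K (MvPolynomial σ K)] {ι : Type*} {f : ι → MvPolynomial σ K} {d : ι → ℕ}

theorem exists_mem_fixedPolynomials_sum_mul_eq [Fintype ι] [NeZero (Nat.card G : K)]
    (hf : ∀ i, f i ∈ fixedPolynomials K σ G) {p : MvPolynomial σ K}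
    (hp : p ∈ fixedPolynomials K σ G) (hspan : p ∈ Ideal.span (Set.range f)) :
    ∃ b : ι → MvPolynomial σ K, (∀ i, b i ∈ fixedPolynomials K σ G) ∧ ∑ i, b i * f i = p := by
  have := Nat.finite_of_card_ne_zero (NeZero.of_neZero_natCast K (n := Nat.card G)).out
  have := Fintype.ofFinite G
  obtain ⟨a, rfl⟩ := Ideal.mem_span_range_iff_exists_fun.1 hspan
  exact ⟨fun i => reynolds G (a i), fun i => reynolds_mem_fixedPolynomials _,
    by rw [← reynolds_sum_mul_of_mem _ a hf, reynolds_eq_self hp]⟩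

theorem IsDegreePreserving.adjoin_eq_fixedPolynomials [Finite ι] [NeZero (Nat.card G : K)]
    (hG : IsDegreePreserving K σ G) (hf : ∀ i, f i ∈ fixedPolynomials K σ G)
    (hd : ∀ i, 0 < d i) (hfd : ∀ i, (f i).IsHomogeneous (d i))
    (hspan : Ideal.span (Set.range f) = hilbertIdeal K σ G) :
    Algebra.adjoin K (Set.range f) = fixedPolynomials K σ G := by
  have := Fintype.ofFinite ι
  refine le_antisymm (Algebra.adjoin_le (Set.range_subset_iff.2 hf)) fun p hp => ?_
  suffices h : ∀ n, ∀ p ∈ fixedPolynomials K σ G, p.IsHomogeneous n →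
      p ∈ Algebra.adjoin K (Set.range f) by
    rw [← sum_homogeneousComponent p]
    exact sum_mem fun n _ => h n _ (hG.homogeneousComponent_mem_fixedPolynomials hp n)
      (homogeneousComponent_isHomogeneous n p)
  intro n
  induction n using Nat.strong_induction_on with
  | _ n ih =>
  intro p hp hpn
  rcases Nat.eq_zero_or_pos n with rfl | hn
  · rw [← totalDegree_zero_iff_isHomogeneous, totalDegree_eq_zero_iff_eq_C] at hpn
    rw [hpn]
    exact Subalgebra.algebraMap_mem _ _
  obtain ⟨b, hb, hsum⟩ := exists_mem_fixedPolynomials_sum_mul_eq hf hp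
    (hspan ▸ Ideal.subset_span ⟨hp, n, hn, hpn⟩)
  rw [← homogeneousComponent_eq_self hpn, ← hsum, homogeneousComponent_sum_mul hfd]
  refine sum_mem fun i _ => ?_
  split_ifs
  · exact mul_mem (ih _ (Nat.sub_lt hn (hd i)) _
      (hG.homogeneousComponent_mem_fixedPolynomials (hb i) _)
      (homogeneousComponent_isHomogeneous _ _)) (Algebra.subset_adjoin ⟨i, rfl⟩)
  · exact zero_mem _

end Generators

section Independence

theorem exists_eq_sum_mul_of_span_image_eq {S ι : Type*} [CommSemiring S] [DecidableEq ι]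
    {h : ι → S} {s : Finset ι} (hs : Ideal.span (h '' s) = Ideal.span (Set.range h)) :
    ∃ c : ι → ι → S, (∀ j, ∑ i ∈ s, c j i * h i = h j) ∧ ∀ j ∈ s, c j = Pi.single j 1 := by
  have hcoeff (j : ι) : ∃ c : ι → S, ∑ i ∈ s, c i * h i = h j ∧ (j ∈ s → c = Pi.single j 1) := by
    by_cases hj : j ∈ s
    · refine ⟨Pi.single j 1, ?_, fun _ => rfl⟩
      rw [Finset.sum_eq_single_of_mem j hj fun i _ hij => by rw [Pi.single_eq_of_ne hij, zero_mul],
        Pi.single_eq_same, one_mul]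
    · have hmem : h j ∈ Ideal.span (h '' s) := hs ▸ Ideal.subset_span ⟨j, rfl⟩
      obtain ⟨c, hc⟩ := (Submodule.mem_span_image_finset_iff_exists_fun' _).1 hmem
      exact ⟨c, hc, fun h => absurd h hj⟩
  choose c hc hcs using hcoeff
  exact ⟨c, hc, hcs⟩

variable {ι : Type*} {f : ι → MvPolynomial σ K} {d : ι → ℕ}

/- Euler's identity expresses `d j • f j` through the partial derivatives of `f j`. -/
theorem exists_sum_mul_eq_of_pderiv_mem [Fintype ι] [Finite σ]
    (hf : ∀ i, (f i).IsHomogeneous (d i)) {c : ι → MvPolynomial σ K}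
    (hc : ∀ k, ∑ j, c j * pderiv k (f j) ∈ Ideal.span (Set.range f)) :
    ∃ b : ι → MvPolynomial σ K, (∀ j, constantCoeff (b j) = 0) ∧
      ∑ j, c j * (d j • f j) = ∑ j, b j * f j := by
  have := Fintype.ofFinite σ
  choose a ha using fun k => Ideal.mem_span_range_iff_exists_fun.1 (hc k)
  refine ⟨fun j => ∑ k, X k * a k j, fun j => by simp, ?_⟩
  calc ∑ j, c j * (d j • f j) = ∑ k, X k * ∑ j, c j * pderiv k (f j) := by
        simp only [← (hf _).sum_X_mul_pderiv, Finset.mul_sum]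
        rw [Finset.sum_comm]
        simp only [mul_left_comm]
    _ = ∑ j, (∑ k, X k * a k j) * f j := by
        simp only [← ha, Finset.mul_sum, Finset.sum_mul, mul_assoc]
        rw [Finset.sum_comm]

variable [CharZero K] [Finite σ] [SMulCommClass G K (MvPolynomial σ K)] [Finite G]

/- Expressing the `h i` through a minimal subset of them that generates the same ideal, Chevalley's
lemma and Euler's identity write some `f k` as a combination of the others. -/
theorem IsDegreePreserving.exists_mem_span_image_compl [Fintype ι]
    (hG : IsDegreePreserving K σ G) {T : Set G} (hT : Subgroup.closure T = ⊤)
    (hrefl : ∀ t ∈ T, IsPseudoReflection K σ t)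
    (hd : ∀ i, 0 < d i) (hfd : ∀ i, (f i).IsHomogeneous (d i))
    (hspan : Ideal.span (Set.range f) = hilbertIdeal K σ G) {h : ι → MvPolynomial σ K} {e : ι → ℕ}
    (hh : ∀ i, h i ∈ fixedPolynomials K σ G) (he : ∀ i, (h i).IsHomogeneous (e i)) {i : ι}
    (hi : h i ≠ 0) (hrel : ∀ m, ∑ j, h j * pderiv m (f j) = 0) :
    ∃ k, f k ∈ Ideal.span (f '' {k}ᶜ) := by
  classical
  obtain ⟨s, -, hs, hsmin⟩ :=
    exists_subset_span_image_eq_and_minimal (R := MvPolynomial σ K) h Finset.univ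
  rw [Finset.coe_univ, Set.image_univ] at hs
  obtain ⟨k, hk⟩ : s.Nonempty := by
    refine Finset.nonempty_iff_ne_empty.2 fun hs0 => hi ?_
    have hmem : h i ∈ Submodule.span (MvPolynomial σ K) (h '' s) :=
      hs ▸ Submodule.subset_span ⟨i, rfl⟩
    simpa [hs0] using hmem
  obtain ⟨c, hc, hcs⟩ := exists_eq_sum_mul_of_span_image_eq hs
  have hsum (m : σ) : ∑ i ∈ s, (∑ j, c j i * pderiv m (f j)) * h i = 0 := by
    have hrel' : ∑ j, (∑ i ∈ s, c j i * h i) * pderiv m (f j) = 0 := by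
      simpa only [hc] using hrel m
    rw [← hrel']
    simp only [Finset.sum_mul]
    rw [Finset.sum_comm]
    simp only [mul_right_comm]
  have hmem (m : σ) : ∑ j, c j k * pderiv m (f j) ∈ Ideal.span (Set.range f) := by
    rw [hspan]
    exact hG.mem_hilbertIdeal_of_sum_mul_eq_zero (u := fun i => ∑ j, c j i * pderiv m (f j))
      hT hrefl hh he hk (hsmin k hk) (hsum m)
  obtain ⟨b, hb, heuler⟩ := exists_sum_mul_eq_of_pderiv_mem hfd hmem
  have hzero : ∑ j, (c j k * C (d j : K) - b j) * f j = 0 := by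
    simp only [sub_mul, Finset.sum_sub_distrib, ← heuler, map_natCast, mul_assoc, nsmul_eq_mul,
      sub_self]
  refine ⟨k, ?_⟩
  rw [Set.compl_eq_univ_sdiff, ← Finset.coe_univ]
  refine mem_span_image_diff_singleton hfd hzero (Finset.mem_univ k) ?_
  rw [hcs k hk, Pi.single_eq_same, one_mul, map_sub, constantCoeff_C, hb, sub_zero]
  exact Nat.cast_ne_zero.2 (hd k).ne'

theorem IsDegreePreserving.algebraicIndependent_of_minimal [Finite ι]
    (hG : IsDegreePreserving K σ G) {T : Set G} (hT : Subgroup.closure T = ⊤)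
    (hrefl : ∀ t ∈ T, IsPseudoReflection K σ t)
    (hf : ∀ i, f i ∈ fixedPolynomials K σ G) (hd : ∀ i, 0 < d i)
    (hfd : ∀ i, (f i).IsHomogeneous (d i))
    (hspan : Ideal.span (Set.range f) = hilbertIdeal K σ G)
    (hmin : ∀ i, f i ∉ Ideal.span (f '' {i}ᶜ)) : AlgebraicIndependent K f := by
  have := Fintype.ofFinite ι
  by_contra hind
  obtain ⟨Q, e, he, ⟨i, hi⟩, hrel⟩ := exists_sum_mul_pderiv_eq_zero hd hfd hind
  have hinv (i : ι) : aeval f (Q i) ∈ fixedPolynomials K σ G :=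
    Algebra.adjoin_le (Set.range_subset_iff.2 hf) (Algebra.adjoin_range_eq_range_aeval K f ▸
      AlgHom.mem_range_self _ (Q i))
  obtain ⟨k, hk⟩ := hG.exists_mem_span_image_compl hT hrefl hd hfd hspan hinv he hi hrel
  exact hmin k hk

end Independence

theorem isAlgebraic_fixedPolynomials [SMulCommClass G K (MvPolynomial σ K)] [Finite G] :
    Algebra.IsAlgebraic (fixedPolynomials K σ G) (MvPolynomial σ K) := by
  have : Algebra.IsInvariant (fixedPolynomials K σ G) (MvPolynomial σ K) G :=
    ⟨fun p hp => ⟨⟨p, hp⟩, rfl⟩⟩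
  have : Algebra.IsIntegral (fixedPolynomials K σ G) (MvPolynomial σ K) :=
    Algebra.IsInvariant.isIntegral _ _ G
  infer_instance

theorem exists_finset_minimal_generators_hilbertIdeal [Finite σ]
    [SMulCommClass G K (MvPolynomial σ K)] :
    ∃ F : Finset (MvPolynomial σ K),
      (∀ p ∈ F, p ∈ fixedPolynomials K σ G ∧ ∃ n, 0 < n ∧ p.IsHomogeneous n) ∧
      Ideal.span (F : Set (MvPolynomial σ K)) = hilbertIdeal K σ G ∧
      ∀ p ∈ F, p ∉ Ideal.span (F \ {p} : Set (MvPolynomial σ K)) := by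
  obtain ⟨F₀, hF₀, hspan₀⟩ := (Submodule.fg_span_iff_fg_span_finset_subset
    {p | p ∈ fixedPolynomials K σ G ∧ ∃ n, 0 < n ∧ p.IsHomogeneous n}).1
      (IsNoetherian.noetherian (R := MvPolynomial σ K) _)
  obtain ⟨F, hF, hspan, hmin⟩ :=
    exists_subset_span_image_eq_and_minimal (R := MvPolynomial σ K) id F₀
  simp only [Set.image_id] at hspan hmin
  exact ⟨F, fun p hp => hF₀ (hF hp), hspan.trans hspan₀.symm, hmin⟩

theorem IsDegreePreserving.exists_algebraicIndependent_adjoin_eq [CharZero K] [Finite σ]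
    [SMulCommClass G K (MvPolynomial σ K)] [Finite G] (hG : IsDegreePreserving K σ G)
    {T : Set G} (hT : Subgroup.closure T = ⊤)
    (hrefl : ∀ t ∈ T, IsPseudoReflection K σ t) :
    ∃ (f : σ → MvPolynomial σ K) (d : σ → ℕ), AlgebraicIndependent K f ∧
      Algebra.adjoin K (Set.range f) = fixedPolynomials K σ G ∧ ∀ i, (f i).IsHomogeneous (d i) := by
  obtain ⟨F, hF, hspan, hmin⟩ := exists_finset_minimal_generators_hilbertIdeal (K := K) (σ := σ)
    (G := G)
  choose hinv d hd hhom using fun p : F => hF p p.2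
  have hrange : Set.range (Subtype.val : F → MvPolynomial σ K) = F := Subtype.range_val
  rw [← hrange] at hspan
  have hadj := hG.adjoin_eq_fixedPolynomials hinv hd hhom hspan
  have hind : AlgebraicIndependent K (Subtype.val : F → MvPolynomial σ K) := by
    refine hG.algebraicIndependent_of_minimal hT hrefl hinv hd hhom hspan fun p => ?_
    rw [Set.compl_eq_univ_sdiff, Set.image_sdiff Subtype.val_injective, Set.image_univ, hrange,
      Set.image_singleton]
    exact hmin p p.2
  have hbasis : IsTranscendenceBasis K (Subtype.val : F → MvPolynomial σ K) := by
    rw [hind.isTranscendenceBasis_iff_isAlgebraic, hadj]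
    exact isAlgebraic_fixedPolynomials
  have hcard := hbasis.lift_cardinalMk_eq_trdeg
  rw [MvPolynomial.trdeg_of_isDomain] at hcard
  obtain ⟨ε⟩ : Nonempty (F ≃ σ) := Cardinal.lift_mk_eq'.1 (by simpa using hcard)
  refine ⟨Subtype.val ∘ ε.symm, d ∘ ε.symm, hind.comp _ ε.symm.injective, ?_, fun i => hhom _⟩
  rw [ε.symm.surjective.range_comp, hadj]

end Chevalley

/-! ### Existence of basic systems -/

section Existence

open MvPolynomial

variable {W : Subgroup (V ≃ₗ[ℂ] V)}

theorem IsReflectionGroup.closure_reflections (hW : IsReflectionGroup W) :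
    Subgroup.closure {s : W | IsReflection s.1} = ⊤ := by
  refine Subgroup.map_injective W.subtype_injective ?_
  rw [MonoidHom.map_closure, ← MonoidHom.range_eq_map, Subgroup.range_subtype]
  convert hW.generated
  ext s
  simp [and_comm]

variable [FiniteDimensional ℂ V]

/-- The composition with `w⁻¹` of polynomial functions on `V`, in coordinates. -/
def translate (w : V ≃ₗ[ℂ] V) : CoordinateRing V →ₐ[ℂ] CoordinateRing V :=
  aeval fun i => linearPolynomial ((finBasis ℂ V).coord i ∘ₗ w.symm.toLinearMap)

theorem evalCoord_translate (w : V ≃ₗ[ℂ] V) (p : CoordinateRing V) (v : V) :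
    evalCoord V (translate w p) v = evalCoord V p (w.symm v) := by
  induction p using MvPolynomial.induction_on with
  | C a => simp [evalCoord_apply]
  | add p q hp hq => simp only [map_add, Pi.add_apply, hp, hq]
  | mul_X p i hp =>
    simp only [map_mul, Pi.mul_apply, hp]
    congr 1
    rw [translate, aeval_X, evalCoord_linearPolynomial, evalCoord_apply, aeval_X]
    rfl

variable (V) in
/-- The action of `GL(V)` on the polynomial functions on `V`, in coordinates. It is not an instance
because for `V = ℂ` it differs from the action on polynomials by way of their coefficients. -/
abbrev translationAction : MulSemiringAction (V ≃ₗ[ℂ] V) (CoordinateRing V) where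
  smul w := translate w
  one_smul p := evalCoord_injective (funext fun v => evalCoord_translate 1 p v)
  mul_smul w w' p := evalCoord_injective <| funext fun v => by
    change evalCoord V (translate (w * w') p) v = evalCoord V (translate w (translate w' p)) v
    simp only [evalCoord_translate]
    rfl
  smul_zero w := map_zero (translate w)
  smul_add w := map_add (translate w)
  smul_one w := map_one (translate w)
  smul_mul w := map_mul (translate w)

attribute [local instance] translationAction

theorem evalCoord_smul (w : V ≃ₗ[ℂ] V) (p : CoordinateRing V) (v : V) :
    evalCoord V (w • p) v = evalCoord V p (w.symm v) :=
  evalCoord_translate w p v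

local instance : SMulCommClass W ℂ (CoordinateRing V) :=
  ⟨fun w => map_smul (translate w.1)⟩

theorem evalCoord_mem_invariants_iff {p : CoordinateRing V} :
    evalCoord V p ∈ invariants W ↔ p ∈ fixedPolynomials ℂ (Fin (finrank ℂ V)) W := by
  constructor
  · intro h w
    exact evalCoord_injective <| funext fun v =>
      (evalCoord_smul w.1 p v).trans (h.2 _ (inv_mem w.2) v)
  · refine fun h => ⟨evalCoord_mem p, fun w hw v => ?_⟩
    have hfix : w⁻¹ • p = p := h ⟨w⁻¹, inv_mem hw⟩
    conv_rhs => rw [← hfix, evalCoord_smul]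
    rfl

theorem isDegreePreserving : IsDegreePreserving ℂ (Fin (finrank ℂ V)) W := by
  intro w n p hp
  have h := hp.aeval _ fun i => linearPolynomial_isHomogeneous
    ((finBasis ℂ V).coord i ∘ₗ w.1.symm.toLinearMap)
  rwa [one_mul] at h

theorem linearPolynomial_dvd_smul_X_sub {s : V ≃ₗ[ℂ] V} {m : Dual ℂ V}
    (hm : LinearMap.ker m ≤ fixedSpace s) (i : Fin (finrank ℂ V)) :
    linearPolynomial m ∣ s • (X i : CoordinateRing V) - X i := by
  set x := (finBasis ℂ V).coord i
  obtain ⟨c, hc⟩ := exists_smul_eq_of_ker_le_ker (m := m)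
    (m' := x ∘ₗ s.symm.toLinearMap - x) fun v hv => by
      have hsv : s.symm v = v := by rw [LinearEquiv.symm_apply_eq, mem_fixedSpace.1 (hm hv)]
      simp [hsv]
  refine ⟨C c, evalCoord_injective (funext fun v => ?_)⟩
  rw [map_sub, Pi.sub_apply, evalCoord_smul, map_mul, Pi.mul_apply, evalCoord_linearPolynomial,
    mul_comm]
  simpa [evalCoord_apply, x] using (LinearMap.congr_fun hc v).symm

theorem linearPolynomial_dvd_smul_sub {s : V ≃ₗ[ℂ] V} {m : Dual ℂ V}
    (hm : LinearMap.ker m ≤ fixedSpace s) (p : CoordinateRing V) :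
    linearPolynomial m ∣ s • p - p := by
  induction p using MvPolynomial.induction_on with
  | C a =>
    have hC : s • (C a : CoordinateRing V) = C a := (translate s).commutes a
    rw [hC, sub_self]
    exact dvd_zero _
  | add p q hp hq =>
    rw [smul_add, add_sub_add_comm]
    exact dvd_add hp hq
  | mul_X p i hp =>
    have hLeibniz : s • (p * X i) - p * X i = s • p * (s • X i - X i) + (s • p - p) * X i := by
      rw [smul_mul']; ring
    rw [hLeibniz]
    exact dvd_add ((linearPolynomial_dvd_smul_X_sub hm i).mul_left _) (hp.mul_right _)

theorem IsReflection.isPseudoReflection {s : W} (hs : IsReflection s.1) :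
    IsPseudoReflection ℂ (Fin (finrank ℂ V)) s := by
  obtain ⟨m, hm0, hm⟩ := Submodule.exists_le_ker_of_lt_top _ (lt_top_iff_ne_top.2 hs.2.1)
  have hker := (hs.2.le_iff.1 hm).resolve_left fun h => hm0 (LinearMap.ker_eq_top.1 h)
  refine ⟨linearPolynomial m, linearPolynomial_isHomogeneous m, fun h => hm0 ?_,
    fun p => linearPolynomial_dvd_smul_sub hker.le p⟩
  ext v
  rw [← congrFun (evalCoord_linearPolynomial m) v, h, map_zero]
  rfl

theorem adjoin_range_evalCoord {f : Fin (finrank ℂ V) → CoordinateRing V}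
    (hf : Algebra.adjoin ℂ (Set.range f) = fixedPolynomials ℂ (Fin (finrank ℂ V)) W) :
    Algebra.adjoin ℂ (Set.range fun i => evalCoord V (f i)) = invariants W := by
  rw [← Function.comp_def, Set.range_comp, ← AlgHom.map_adjoin, hf]
  ext g
  constructor
  · rintro ⟨p, hp, rfl⟩
    exact evalCoord_mem_invariants_iff.2 hp
  · intro hg
    obtain ⟨p, rfl⟩ := exists_evalCoord_eq hg.1
    exact ⟨p, evalCoord_mem_invariants_iff.1 hg, rfl⟩

theorem IsReflectionGroup.exists_isBasicSystemWithDegrees (hW : IsReflectionGroup W) :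
    ∃ d f, IsBasicSystemWithDegrees W d f := by
  have := hW.finite
  obtain ⟨f, d, hind, hadj, hhom⟩ := isDegreePreserving.exists_algebraicIndependent_adjoin_eq
    hW.closure_reflections fun _ hs => hs.isPseudoReflection
  refine ⟨d ∘ Tuple.sort d, fun i => evalCoord V (f (Tuple.sort d i)),
    (hind.map' evalCoord_injective).comp _ (Tuple.sort d).injective,
    adjoin_range_evalCoord (f := f ∘ Tuple.sort d) ?_,
    fun i => evalCoord_mem_homogeneousFunctions (hhom _), Tuple.monotone_sort d⟩
  rw [(Tuple.sort d).surjective.range_comp, hadj]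

end Existence

/-! ### Regular degrees -/

section RegularDegrees

variable {W : Subgroup (V ≃ₗ[ℂ] V)} {f : Fin (finrank ℂ V) → V → ℂ}

theorem IsSystemOfBasicInvariants.isBasicSystemWithDegrees (hf : IsSystemOfBasicInvariants W f) :
    IsBasicSystemWithDegrees W (degrees W) f := by
  obtain ⟨d, hd⟩ := hf
  rwa [hd.degrees_eq]

variable {l : Submodule ℂ V → Dual ℂ V} {i : Fin (finrank ℂ V)}

theorem IsSystemOfBasicInvariants.natDegree_asPolynomialIn_discriminant
    (hf : IsSystemOfBasicInvariants W f) (hW : IsReflectionGroup W) (hl : IsChoiceOfForms W l)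
    (hmonic : IsMonicIn i (discriminant W l f)) :
    ((asPolynomialIn i (discriminant W l f)).natDegree : ℚ) =
      ((numReflections W : ℚ) + numHyperplanes W) / degrees W i := by
  have hf' := hf.isBasicSystemWithDegrees
  have hweight := mul_eq_of_coeff_single_ne_zero
    (hf'.discriminant_isWeightedHomogeneous hW hl) hmonic.coeff_ne_zero
  rw [eq_div_iff (Nat.cast_ne_zero.2 (hf'.degree_pos i).ne')]
  exact_mod_cast hweight

variable [FiniteDimensional ℂ V]

theorem IsReflectionGroup.exists_isSystemOfBasicInvariants (hW : IsReflectionGroup W) :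
    ∃ f, IsSystemOfBasicInvariants W f := by
  obtain ⟨d, f, hf⟩ := hW.exists_isBasicSystemWithDegrees
  exact ⟨f, d, hf⟩

theorem IsReflectionGroup.isRegularNumber_degrees_iff (hW : IsReflectionGroup W)
    (hl : IsChoiceOfForms W l) :
    IsRegularNumber W (degrees W i) ↔
      ∃ f, IsSystemOfBasicInvariants W f ∧ IsMonicIn i (discriminant W l f) := by
  constructor
  · intro h
    obtain ⟨f, hf⟩ := hW.exists_isSystemOfBasicInvariants
    exact hf.isBasicSystemWithDegrees.exists_isMonicIn_of_isRegularNumber hW hl h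
  · rintro ⟨f, hf, hmonic⟩
    exact hf.isBasicSystemWithDegrees.isRegularNumber_of_isMonicIn hW hl hmonic

end RegularDegrees

end ComplexReflection

end

theorem mainTheorem3_general {V : Type*} [AddCommGroup V] [Module ℂ V] [FiniteDimensional ℂ V]
    (W : Subgroup (V ≃ₗ[ℂ] V)) (hW : ComplexReflection.IsReflectionGroup W)
    (l : Submodule ℂ V → Module.Dual ℂ V) (hl : ComplexReflection.IsChoiceOfForms W l)
    (i₀ : Fin (Module.finrank ℂ V)) :
    ((ComplexReflection.IsRegularNumber W (ComplexReflection.degrees W i₀) ↔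
        ∃ f, ComplexReflection.IsSystemOfBasicInvariants W f ∧
          ComplexReflection.IsMonicIn i₀ (ComplexReflection.discriminant W l f)) ∧
      ∀ f, ComplexReflection.IsSystemOfBasicInvariants W f →
        ComplexReflection.IsMonicIn i₀ (ComplexReflection.discriminant W l f) →
        ((ComplexReflection.asPolynomialIn i₀
            (ComplexReflection.discriminant W l f)).natDegree : ℚ) =
          ((ComplexReflection.numReflections W : ℚ) + ComplexReflection.numHyperplanes W) /
            ComplexReflection.degrees W i₀) ∧
    ((∀ i, ComplexReflection.degrees W i₀ ∣ ComplexReflection.degrees W i → i = i₀) →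
      List.TFAE [
        ComplexReflection.IsRegularNumber W (ComplexReflection.degrees W i₀),
        ∃ f, ComplexReflection.IsSystemOfBasicInvariants W f ∧
          ComplexReflection.IsMonicIn i₀ (ComplexReflection.discriminant W l f),
        ∀ f, ComplexReflection.IsSystemOfBasicInvariants W f →
          ComplexReflection.IsMonicIn i₀ (ComplexReflection.discriminant W l f)]) := by
  have hiff := hW.isRegularNumber_degrees_iff (i := i₀) hl
  refine ⟨⟨hiff, fun f hf hmonic => hf.natDegree_asPolynomialIn_discriminant hW hl hmonic⟩,
    fun hi => ?_⟩
  tfae_have 1 ↔ 2 := hiff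
  tfae_have 1 → 3 := fun hreg f hf =>
    hf.isBasicSystemWithDegrees.isMonicIn_of_isRegularNumber hW hl hreg hi
  tfae_have 3 → 2 := fun hall =>
    hW.exists_isSystemOfBasicInvariants.imp fun f hf => ⟨hf, hall f hf⟩
  tfae_finish

theorem mainTheorem3 {V : Type*} [AddCommGroup V] [Module ℂ V] [FiniteDimensional ℂ V]
    (W : Subgroup (V ≃ₗ[ℂ] V)) (hW : ComplexReflection.IsIrreducibleReflectionGroup W)
    (l : Submodule ℂ V → Module.Dual ℂ V) (hl : ComplexReflection.IsChoiceOfForms W l)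
    (i₀ : Fin (Module.finrank ℂ V)) :
    ((ComplexReflection.IsRegularNumber W (ComplexReflection.degrees W i₀) ↔
        ∃ f, ComplexReflection.IsSystemOfBasicInvariants W f ∧
          ComplexReflection.IsMonicIn i₀ (ComplexReflection.discriminant W l f)) ∧
      ∀ f, ComplexReflection.IsSystemOfBasicInvariants W f →
        ComplexReflection.IsMonicIn i₀ (ComplexReflection.discriminant W l f) →
        ((ComplexReflection.asPolynomialIn i₀
            (ComplexReflection.discriminant W l f)).natDegree : ℚ) =
          ((ComplexReflection.numReflections W : ℚ) + ComplexReflection.numHyperplanes W) /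
            ComplexReflection.degrees W i₀) ∧
    ((∀ i, ComplexReflection.degrees W i₀ ∣ ComplexReflection.degrees W i → i = i₀) →
      List.TFAE [
        ComplexReflection.IsRegularNumber W (ComplexReflection.degrees W i₀),
        ∃ f, ComplexReflection.IsSystemOfBasicInvariants W f ∧
          ComplexReflection.IsMonicIn i₀ (ComplexReflection.discriminant W l f),
        ∀ f, ComplexReflection.IsSystemOfBasicInvariants W f →
          ComplexReflection.IsMonicIn i₀ (ComplexReflection.discriminant W l f)]) :=
  mainTheorem3_general W ⟨hW.finite, hW.generated⟩ l hl i₀
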